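/- **Setting.** A platform has $N\ge 1$ items with revenues $r_i>0$ and $M\ge 1$ user types. In round $t=1,2,\dots$ a user of random type $J_t$ arrives, independently of the past, with $\mathbb P[J_t=j]=p_{t,j}$, where the distributions $\boldsymbol p_t$ on $[M]$ are periodic, $\boldsymbol p_{t+Q}=\boldsymbol p_t$, with a known period $Q\ge 1$ and unknown values; every type has positive average arrival probability over a period. A type-$j$ user who is offered item $i$ buys it with unknown probability $y_{i,j}\in(0,1)$. Let $\Delta_N^M$ be the set of matrices $\boldsymbol x=(x_{i,j})$ whose columns are probability vectors on $[N]$ ($x_{i,j}$ is the probability of offering item $i$ to a type-$j$ user). Let $\Theta$ be the set of instances $\boldsymbol\theta=(\boldsymbol p,\boldsymbol y,\boldsymbol r)$ with $\boldsymbol p$ a probability vector, $y_{i,j}\in(0,1)$, $r_i>0$, and $\mathrm{rev}(\boldsymbol x,\boldsymbol\theta)=\sum_{i,j}r_ip_jy_{i,j}x_{i,j}$. Given are item and user outcome matrices $\boldsymbol L(\boldsymbol\theta),\boldsymbol U(\boldsymbol\theta)\in\mathbb R^{N\times M}$, with outcomes $O^I_i(\boldsymbol x,\boldsymbol\theta)=\sum_jL_{i,j}(\boldsymbol\theta)x_{i,j}$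 and $O^U_j(\boldsymbol x,\boldsymbol\theta)=\sum_iU_{i,j}(\boldsymbol\theta)x_{i,j}$; an item-fair solution $\boldsymbol f^I(\boldsymbol\theta)\in\Delta_N^M$, maximizing a given social welfare function of the vector of item outcomes over $\Delta_N^M$; the user-fair solution $\boldsymbol f^U(\boldsymbol\theta)$, which always offers type $j$ an item maximizing $U_{i,j}(\boldsymbol\theta)$; and $\delta^I,\delta^U\in[0,1]$. For $\eta\ge 0$, let $\mathrm{FAIR}(\boldsymbol\theta,\eta)$ be the problem of maximizing $\mathrm{rev}(\boldsymbol x,\boldsymbol\theta)$ over $\boldsymbol x\in\Delta_N^M$ subject to $O^I_i(\boldsymbol x,\boldsymbol\theta)\ge\delta^IO^I_i(\boldsymbol f^I(\boldsymbol\theta),\boldsymbol\theta)-\eta$ for all $i$ and $O^U_j(\boldsymbol x,\boldsymbol\theta)\ge\delta^UO^U_j(\boldsymbol f^U(\boldsymbol\theta),\boldsymbol\theta)-\eta$ for all $j$. Let $\bar{\boldsymbol\theta}=(\bar{\boldsymbol p},\boldsymbol y,\boldsymbol r)$ with $\bar{\boldsymbol p}=\frac1Q\sum_{t=1}^Q\boldsymbol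 p_t$, and $\boldsymbol\theta_T=(\frac1T\sum_{t=1}^T\boldsymbol p_t,\boldsymbol y,\boldsymbol r)$. Assume that there are $B,\zeta>0$ such that, for all $\tilde{\boldsymbol\theta}\in\Theta$ with $\|\tilde{\boldsymbol\theta}-\bar{\boldsymbol\theta}\|_\infty\le\zeta$, each of $\|\boldsymbol L(\bar{\boldsymbol\theta})-\boldsymbol L(\tilde{\boldsymbol\theta})\|_\infty$, $\|\boldsymbol U(\bar{\boldsymbol\theta})-\boldsymbol U(\tilde{\boldsymbol\theta})\|_\infty$, $\|\boldsymbol f^I(\bar{\boldsymbol\theta})-\boldsymbol f^I(\tilde{\boldsymbol\theta})\|_\infty$ is at most $B\|\bar{\boldsymbol\theta}-\tilde{\boldsymbol\theta}\|_\infty$. Assume also that, for the horizon $T$ considered, $\mathrm{FAIR}(\boldsymbol\theta_T,0)$ is feasible, and let $\boldsymbol x^\star$ be an optimal solution of it. **Algorithm (FORM with a sliding window).** Fix the horizon $T$. Put $\mathcal W=\lceil QT^{2/3}\rceil$, $\epsilon_t=\min\{N^{-1},N^{-2/3}t^{-1/3}\}$, $\Gamma_{y,t}=2\log T\big/\sqrt{\epsilon_t\max\{1,\,t/\log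 T-\sqrt{t\log(T)/2}\}}$, $\Gamma_{p,t}=5\sqrt{\log(3T)/\mathcal W}$, $\eta_t=M\log(T)\max\{\Gamma_{y,t},\Gamma_{p,t}\}$. Start with $\hat y_{1,i,j}=\frac12$, $\hat p_{1,j}=\frac1M$. In round $t$, let $\hat{\boldsymbol x}_t$ be an optimal solution of $\mathrm{FAIR}(\hat{\boldsymbol\theta}_t,\eta_t)$ at $\hat{\boldsymbol\theta}_t=(\hat{\boldsymbol p}_t,\hat{\boldsymbol y}_t,\boldsymbol r)$ (an arbitrary element of $\Delta_N^M$ if $\hat{\boldsymbol\theta}_t\notin\Theta$ or this problem is infeasible), put $x_{t,i,j}=(1-N\epsilon_t)\hat x_{t,i,j}+\epsilon_t$, observe $J_t$, offer $I_t\sim\boldsymbol x_{t,:,J_t}$, and observe whether the item is bought ($z_t=1$) or not ($z_t=0$). Then set $$\hat p_{t+1,j}=\frac1{\min\{t,\mathcal W\}}\sum_{\tau=\max\{1,t-\mathcal W+1\}}^{t}\mathbb I\{J_\tau=j\},\qquad \hat y_{t+1,i,j}=\frac1{n_{j,t}}\sum_{\tau\le t,\,J_\tau=j}\frac{\mathbb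 I\{I_\tau=i,\,z_\tau=1\}}{x_{\tau,i,j}},$$ where $n_{j,t}$ is the number of type-$j$ arrivals in rounds $1,\dots,t$, and $\hat y_{t+1,i,j}=\frac12$ if $n_{j,t}=0$. **Theorem.** Let $\mathcal R(T)=\frac1T\sum_{t=1}^T\big(\mathrm{rev}(\boldsymbol x^\star,\boldsymbol\theta_T)-\mathrm{rev}(\boldsymbol x_t,\boldsymbol\theta_T)\big)$ be the revenue regret, and let the fairness regret $\mathcal R_F(T)$ be the maximum of $\max_i\frac1T\sum_{t=1}^T\big(\delta^IO^I_i(\boldsymbol f^I(\boldsymbol\theta_T),\boldsymbol\theta_T)-O^I_i(\boldsymbol x_t,\boldsymbol\theta_T)\big)^+$ and $\max_j\frac1T\sum_{t=1}^T\big(\delta^UO^U_j(\boldsymbol f^U(\boldsymbol\theta_T),\boldsymbol\theta_T)-O^U_j(\boldsymbol x_t,\boldsymbol\theta_T)\big)^+$. There is a universal constant $C>0$ such that in every such setting, for all sufficiently large $T$ (how large may depend on $N$, $M$, $Q$, the arrival distributions, $\boldsymbol y$, $\boldsymbol r$, the fairness specification and its constants), $$\mathbb E[\mathcal R(T)]\le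 C\,Q\,\|\boldsymbol r\|_\infty\,MN^{1/3}T^{-1/3},\qquad \mathbb E[\mathcal R_F(T)]\le C\,(\log T)^{5/2}\,MN^{1/3}T^{-1/3}.$$ In particular, the revenue regret is $O(MN^{1/3}T^{-1/3})$, and the fairness regret is $O(MN^{1/3}T^{-1/3})$ up to the logarithmic factor $(\log T)^{5/2}$. -/

import Mathlib

open scoped BigOperators

noncomputable section

namespace FORM

/-- A problem instance `θ = (p, y, r)`: arrival probabilities, purchase probabilities, revenues.
The norm of this product type is the maximum of the absolute values of all entries. -/
abbrev Instance (N M : ℕ) : Type := (Fin M → ℝ) × (Fin N → Fin M → ℝ) × (Fin N → ℝ)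

/-- The arrival probabilities of an instance. -/
abbrev Instance.p {N M : ℕ} (θ : Instance N M) : Fin M → ℝ := θ.1

/-- The purchase probabilities of an instance. -/
abbrev Instance.y {N M : ℕ} (θ : Instance N M) : Fin N → Fin M → ℝ := θ.2.1

/-- The item revenues of an instance. -/
abbrev Instance.r {N M : ℕ} (θ : Instance N M) : Fin N → ℝ := θ.2.2

/-- The set `Θ` of problem instances: `p` is a probability vector, every `y i j` lies in `(0, 1)`,
every revenue is positive. -/
def instances (N M : ℕ) : Set (Instance N M) :=
  {θ | θ.p ∈ stdSimplex ℝ (Fin M) ∧ (∀ i j, θ.y i j ∈ Set.Ioo (0 : ℝ) 1) ∧ ∀ i, 0 < θ.r i}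

/-- The set `Δ_N^M` of recommendation probabilities: `x i j` is the probability of offering item
`i` to a user of type `j`. -/
def recommendations (N M : ℕ) : Set (Fin N → Fin M → ℝ) :=
  {x | ∀ j, (fun i => x i j) ∈ stdSimplex ℝ (Fin N)}

/-- Expected revenue of one round. -/
def rev {N M : ℕ} (x : Fin N → Fin M → ℝ) (θ : Instance N M) : ℝ :=
  ∑ i, ∑ j, θ.r i * θ.p j * θ.y i j * x i j

/-- Expected outcome of item `i` for the item outcome matrix `L`. -/
def itemOutcome {N M : ℕ} (L x : Fin N → Fin M → ℝ) (i : Fin N) : ℝ := ∑ j, L i j * x i j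

/-- Expected outcome of a user of type `j` for the user outcome matrix `U`. -/
def userOutcome {N M : ℕ} (U x : Fin N → Fin M → ℝ) (j : Fin M) : ℝ := ∑ i, U i j * x i j

/-- `f` is an item-fair solution: it maximizes the social welfare `w` of the vector of item
outcomes over all recommendation probabilities. -/
def IsItemFair {N M : ℕ} (w : (Fin N → ℝ) → ℝ) (L f : Fin N → Fin M → ℝ) : Prop :=
  f ∈ recommendations N M ∧
    ∀ x ∈ recommendations N M, w (itemOutcome L x) ≤ w (itemOutcome L f)

/-- `f` is a user-fair solution: every type `j` is always offered one item that has the largest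
entry in column `j` of `U` (ties are broken arbitrarily). -/
def IsUserFair {N M : ℕ} (U f : Fin N → Fin M → ℝ) : Prop :=
  ∃ best : Fin M → Fin N, (∀ i j, U i j ≤ U (best j) j) ∧
    ∀ i j, f i j = if i = best j then 1 else 0

/-- The fairness specification chosen by the platform. -/
structure Spec (N M : ℕ) where
  /-- item outcome matrix of an instance -/
  L : Instance N M → Fin N → Fin M → ℝ
  /-- user outcome matrix of an instance -/
  U : Instance N M → Fin N → Fin M → ℝ
  /-- item social welfare function of the vector of item outcomes; it may depend on the instance,
  as the one of the Kalai-Smorodinsky solution does -/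
  swf : Instance N M → (Fin N → ℝ) → ℝ
  /-- item-fair solution of an instance -/
  fI : Instance N M → Fin N → Fin M → ℝ
  /-- user-fair solution of an instance -/
  fU : Instance N M → Fin N → Fin M → ℝ
  /-- fairness parameter for items -/
  δI : ℝ
  /-- fairness parameter for users -/
  δU : ℝ

/-- The fair solutions are what their names say on all of `Θ`, and the fairness parameters lie in
`[0, 1]`. -/
def Spec.Valid {N M : ℕ} (S : Spec N M) : Prop :=
  (∀ θ ∈ instances N M, IsItemFair (S.swf θ) (S.L θ) (S.fI θ)) ∧
  (∀ θ ∈ instances N M, IsUserFair (S.U θ) (S.fU θ)) ∧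
  S.δI ∈ Set.Icc (0 : ℝ) 1 ∧ S.δU ∈ Set.Icc (0 : ℝ) 1

/-- Local Lipschitzness at `θ`, in the maximum norm, of the outcome matrices and of the item-fair
solution. -/
def Spec.LocallyLipschitzAt {N M : ℕ} (S : Spec N M) (θ : Instance N M) : Prop :=
  ∃ B ζ : ℝ, 0 < B ∧ 0 < ζ ∧ ∀ θ' ∈ instances N M, ‖θ' - θ‖ ≤ ζ →
    ‖S.L θ - S.L θ'‖ ≤ B * ‖θ - θ'‖ ∧
    ‖S.U θ - S.U θ'‖ ≤ B * ‖θ - θ'‖ ∧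
    ‖S.fI θ - S.fI θ'‖ ≤ B * ‖θ - θ'‖

/-- The feasible set of the fair recommendation problem at `θ` with all fairness constraints
relaxed by `η`. The problem without relaxation is the case `η = 0`. -/
def Spec.feasible {N M : ℕ} (S : Spec N M) (θ : Instance N M) (η : ℝ) :
    Set (Fin N → Fin M → ℝ) :=
  {x | x ∈ recommendations N M ∧
    (∀ i, S.δI * itemOutcome (S.L θ) (S.fI θ) i - η ≤ itemOutcome (S.L θ) x i) ∧
    ∀ j, S.δU * userOutcome (S.U θ) (S.fU θ) j - η ≤ userOutcome (S.U θ) x j}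

/-- `x` is an optimal solution of the fair recommendation problem at `θ` relaxed by `η`. -/
def Spec.IsOptimal {N M : ℕ} (S : Spec N M) (θ : Instance N M) (η : ℝ)
    (x : Fin N → Fin M → ℝ) : Prop :=
  x ∈ S.feasible θ η ∧ ∀ x' ∈ S.feasible θ η, rev x' θ ≤ rev x θ

/-- What is observed in one round: the user type, the offered item, the purchase decision. -/
abbrev Obs (N M : ℕ) : Type := Fin M × Fin N × Bool

/-- The history of the completed rounds, most recent round first. -/
abbrev History (N M : ℕ) : Type := List (Obs N M)

/-- Magnitude of exploration `ε_t = min {1 / N, N ^ (-2/3) t ^ (-1/3)}`. -/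
def explore (N t : ℕ) : ℝ :=
  min ((N : ℝ)⁻¹) ((N : ℝ) ^ (-(2 / 3) : ℝ) * (t : ℝ) ^ (-(1 / 3) : ℝ))

/-- Window size `W = Q T ^ (2/3)`, rounded up. -/
def window (Q T : ℕ) : ℕ := ⌈(Q : ℝ) * (T : ℝ) ^ (2 / 3 : ℝ)⌉₊

/-- Confidence radius `Γ_{y,t}` of the purchase probabilities. -/
def gammaY (N T t : ℕ) : ℝ :=
  2 * Real.log T /
    Real.sqrt (explore N t * max 1 (t / Real.log T - Real.sqrt (t * Real.log T / 2)))

/-- Confidence radius `Γ_{p,t} = 5 √(log (3T)) / √W` of the arrival probabilities. -/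
def gammaP (Q T : ℕ) : ℝ := 5 * Real.sqrt (Real.log (3 * T)) / Real.sqrt (window Q T)

/-- Magnitude of relaxation `η_t = M log(T) max {Γ_{y,t}, Γ_{p,t}}`. -/
def relax (N M Q T t : ℕ) : ℝ := M * Real.log T * max (gammaY N T t) (gammaP Q T)

/-- Number of users of type `j` in a history. -/
def arrivals {N M : ℕ} (h : History N M) (j : Fin M) : ℕ := h.countP (fun o => o.1 = j)

/-- Estimated arrival probabilities after the history `h`: the empirical frequencies in the most
recent `w` rounds (in all rounds if there were fewer), `1 / M` before the first round. -/
def pHat {N M : ℕ} (w : ℕ) (h : History N M) (j : Fin M) : ℝ :=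
  if h = [] then (M : ℝ)⁻¹ else (arrivals (h.take w) j : ℝ) / (min h.length w : ℕ)

/-- The recommendation probabilities used after the history `h`, that is in round
`t = h.length + 1`: `x_t = (1 - N ε_t) x̂_t + ε_t`, where `xhat h = x̂_t`. -/
def xRec {N M : ℕ} (xhat : History N M → Fin N → Fin M → ℝ) (h : History N M)
    (i : Fin N) (j : Fin M) : ℝ :=
  (1 - N * explore N (h.length + 1)) * xhat h i j + explore N (h.length + 1)

/-- The sum of the inverse probability weighted purchases of item `i` by users of type `j`. -/
def ipwSum {N M : ℕ} (xhat : History N M → Fin N → Fin M → ℝ) :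
    History N M → Fin N → Fin M → ℝ
  | [], _, _ => 0
  | o :: h, i, j =>
      ipwSum xhat h i j +
        if o.1 = j ∧ o.2.1 = i ∧ o.2.2 = true then 1 / xRec xhat h i j else 0

/-- Estimated purchase probabilities after the history `h`; the initial value `1 / 2` is kept as
long as no user of type `j` has arrived. -/
def yHat {N M : ℕ} (xhat : History N M → Fin N → Fin M → ℝ) (h : History N M)
    (i : Fin N) (j : Fin M) : ℝ :=
  if arrivals h j = 0 then 1 / 2 else ipwSum xhat h i j / arrivals h j

/-- The estimated instance after the history `h`. -/
def thetaHat {N M : ℕ} (w : ℕ) (r : Fin N → ℝ) (xhat : History N M → Fin N → Fin M → ℝ)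
    (h : History N M) : Instance N M :=
  (pHat w h, yHat xhat h, r)

/-- `xhat` is the choice of `x̂_t` made by the algorithm with horizon `T`, period length `Q` and
sliding-window estimates of the arrival probabilities: after every history `h`, that is in round
`t = h.length + 1`, it is an optimal solution of the problem at the estimated instance relaxed by
`η_t`. Where this is meaningless (the estimate lies outside `Θ` or the relaxed problem is
infeasible), any recommendation probabilities may be chosen. -/
def IsFORM {N M : ℕ} (S : Spec N M) (r : Fin N → ℝ) (Q T : ℕ)
    (xhat : History N M → Fin N → Fin M → ℝ) : Prop :=
  ∀ h : History N M, xhat h ∈ recommendations N M ∧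
    (thetaHat (window Q T) r xhat h ∈ instances N M →
      (S.feasible (thetaHat (window Q T) r xhat h) (relax N M Q T (h.length + 1))).Nonempty →
      S.IsOptimal (thetaHat (window Q T) r xhat h) (relax N M Q T (h.length + 1)) (xhat h))

/-- Probability that the first rounds produce the history `h`, when the user in round `t` has type
`j` with probability `parr t j`, independently of the past, is offered item `i` with probability
`x_{t,i,j}`, and purchases it with probability `y i j`. -/
def histProb {N M : ℕ} (parr : ℕ → Fin M → ℝ) (y : Fin N → Fin M → ℝ)
    (xhat : History N M → Fin N → Fin M → ℝ) : History N M → ℝ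
  | [] => 1
  | o :: h =>
      histProb parr y xhat h *
        (parr (h.length + 1) o.1 * xRec xhat h o.2.1 o.1 *
          if o.2.2 = true then y o.2.1 o.1 else 1 - y o.2.1 o.1)

/-- Expectation of a function of the history of the first `T` rounds. -/
def expect {N M : ℕ} (parr : ℕ → Fin M → ℝ) (y : Fin N → Fin M → ℝ)
    (xhat : History N M → Fin N → Fin M → ℝ) (T : ℕ) (F : History N M → ℝ) : ℝ :=
  ∑ h : List.Vector (Obs N M) T, histProb parr y xhat h.toList * F h.toList

/-- The recommendation probabilities used in round `k + 1` when the history of all `T` rounds is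
`h`: the algorithm has then seen the first `k` rounds. -/
def xRound {N M : ℕ} (xhat : History N M → Fin N → Fin M → ℝ) (T : ℕ) (h : History N M)
    (k : ℕ) : Fin N → Fin M → ℝ :=
  xRec xhat (h.drop (T - k))

/-- Revenue regret against `xstar` under the instance `θ`. -/
def revRegret {N M : ℕ} (θ : Instance N M) (xhat : History N M → Fin N → Fin M → ℝ)
    (xstar : Fin N → Fin M → ℝ) (T : ℕ) (h : History N M) : ℝ :=
  1 / (T : ℝ) * ∑ k ∈ Finset.range T, (rev xstar θ - rev (xRound xhat T h k) θ)

/-- Fairness regret: the largest time-averaged violation of a fairness constraint of an item or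
of a user type, under the instance `θ`. -/
def fairRegret {N M : ℕ} (S : Spec N M) (θ : Instance N M)
    (xhat : History N M → Fin N → Fin M → ℝ) (T : ℕ) (h : History N M) : ℝ :=
  max
    (⨆ i : Fin N, 1 / (T : ℝ) * ∑ k ∈ Finset.range T,
      max (S.δI * itemOutcome (S.L θ) (S.fI θ) i -
        itemOutcome (S.L θ) (xRound xhat T h k) i) 0)
    (⨆ j : Fin M, 1 / (T : ℝ) * ∑ k ∈ Finset.range T,
      max (S.δU * userOutcome (S.U θ) (S.fU θ) j -
        userOutcome (S.U θ) (xRound xhat T h k) j) 0)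

/-- The average of the arrival distributions of the rounds `1, …, n`. -/
def meanArrival {M : ℕ} (parr : ℕ → Fin M → ℝ) (n : ℕ) (j : Fin M) : ℝ :=
  1 / (n : ℝ) * ∑ t ∈ Finset.Icc 1 n, parr t j

end FORM

end

open FORM

open FORM

noncomputable section

/-! Write `l = log T`, let `θ₀` be the instance with the period-averaged arrival probabilities, and
consider round `t = k + 1` with `√T ≤ k < T`. The regret is a sum of three losses: the uniform
exploration, the reaction of the optimization problem to estimation errors, and the rounds in which
nothing is guaranteed.

Estimation. The arrival counts and the inverse probability weighted purchases, centred at their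
conditional means, are martingales. Their exponential moments (`expect_exp_le`) show that, outside
an event of probability `O(NM / T)`, all estimates are within `ρ = O(l t ^ (-1/3))` of `θ₀`
(`abs_estimate_sub_le`); the constant depends on the instance. By periodicity the instance `θ_T` of
the benchmark is within `Q / T` of `θ₀`.

Optimization. The relaxation satisfies `η_t ≥ l ^ 2 t ^ (-1/3)` (`relax_lower`), so for large `T` it
exceeds every constant multiple of `ρ`. Hence solutions that are feasible at `θ₀` or at `θ_T` remain
feasible for the relaxed problem at the estimated instance. The price `η_t` of relaxing would spoil
the revenue rate, being larger by `M l ^ (5/2)` than the permitted order. It is avoided as follows.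
By Hoffman's error bound (`exists_hoffman_bound`) the chosen `x` has a neighbour `z`, optimal at
`θ₀`, at distance `O(η_t + gap)`, where `gap` is the revenue lost at `θ₀`. At the estimated instance
`x` is at least as good as `z`, so `gap` is at most the change of the revenue of the direction `z -
x` between the two instances, which is `O(ρ ‖x - z‖) = O(ρ (η_t + gap))`. Thus `gap = O(ρ η_t)`, a
second-order quantity (`exists_perturbation_bound`). It is negligible against the exploration loss
`‖r‖ N ^ (1/3) t ^ (-1/3)`, which alone determines the revenue rate. The fairness violation is first
order, `η_t` plus smaller terms, and `relax_upper` gives its rate with the factor `l ^ (5/2)`.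

Summation. `exists_round_bound` collects the bounds for one round and `expect_average_le` averages
them. The first `√T` or so rounds and the rounds after a bad event have bounded loss; together they
cost `O(√T)`, which is below `T ^ (2/3)`. -/

/-- Conditional probability of the next observation given the history. -/
def stepProb {N M : ℕ} (parr : ℕ → Fin M → ℝ) (y : Fin N → Fin M → ℝ)
    (xhat : History N M → Fin N → Fin M → ℝ) (h : History N M) (o : Obs N M) : ℝ :=
  parr (h.length + 1) o.1 * xRec xhat h o.2.1 o.1 *
    if o.2.2 = true then y o.2.1 o.1 else 1 - y o.2.1 o.1

/-! ### Expectations over histories and exponential moments -/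

section Expect

variable {N M : ℕ} {parr : ℕ → Fin M → ℝ} {y : Fin N → Fin M → ℝ}
  {xhat : History N M → Fin N → Fin M → ℝ}

lemma expect_zero (F : History N M → ℝ) : expect parr y xhat 0 F = F [] := by
  unfold expect
  rw [Fintype.sum_subsingleton _ List.Vector.nil]
  simp [histProb]

/-- A nonempty vector is its head and its tail. -/
def vectorConsEquiv (α : Type*) (n : ℕ) : α × List.Vector α n ≃ List.Vector α (n + 1) where
  toFun p := p.1 ::ᵥ p.2
  invFun v := (v.head, v.tail)
  left_inv p := by simp
  right_inv v := by simp

/-- Tower property: the newest observation is the head of the history, so conditioning on the past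
means summing over the head. All later inductions over rounds rest on this. -/
lemma expect_succ (n : ℕ) (F : History N M → ℝ) :
    expect parr y xhat (n + 1) F =
      expect parr y xhat n (fun h => ∑ o, stepProb parr y xhat h o * F (o :: h)) := by
  unfold expect
  rw [← (vectorConsEquiv (Obs N M) n).sum_comp, Fintype.sum_prod_type, Finset.sum_comm]
  refine Finset.sum_congr rfl fun v _ => ?_
  rw [Finset.mul_sum]
  refine Finset.sum_congr rfl fun o _ => ?_
  simp only [vectorConsEquiv, Equiv.coe_fn_mk, List.Vector.toList_cons, histProb, stepProb]
  ring

lemma expect_congr (n : ℕ) {F G : History N M → ℝ} (h : ∀ h, h.length = n → F h = G h) :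
    expect parr y xhat n F = expect parr y xhat n G := by
  unfold expect
  refine Finset.sum_congr rfl fun v _ => ?_
  rw [h _ (by simp)]

lemma expect_add (n : ℕ) (F G : History N M → ℝ) :
    expect parr y xhat n (fun h => F h + G h) =
      expect parr y xhat n F + expect parr y xhat n G := by
  unfold expect
  simp only [mul_add, Finset.sum_add_distrib]

lemma expect_const_mul (n : ℕ) (c : ℝ) (F : History N M → ℝ) :
    expect parr y xhat n (fun h => c * F h) = c * expect parr y xhat n F := by
  unfold expect
  rw [Finset.mul_sum]
  exact Finset.sum_congr rfl fun v _ => by ring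

lemma expect_sum {ι : Type*} (s : Finset ι) (n : ℕ) (F : ι → History N M → ℝ) :
    expect parr y xhat n (fun h => ∑ i ∈ s, F i h) = ∑ i ∈ s, expect parr y xhat n (F i) := by
  unfold expect
  rw [Finset.sum_comm]
  exact Finset.sum_congr rfl fun v _ => by rw [Finset.mul_sum]

lemma explore_nonneg (N t : ℕ) : 0 ≤ explore N t := by
  unfold explore
  exact le_min (by positivity) (by positivity)

lemma explore_mul_le_one (N t : ℕ) : (N : ℝ) * explore N t ≤ 1 := by
  rcases Nat.eq_zero_or_pos N with rfl | hN
  · simp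
  · calc (N : ℝ) * explore N t ≤ N * (N : ℝ)⁻¹ := by
          gcongr; exact min_le_left _ _
      _ = 1 := by field_simp

lemma xRec_mem {h : History N M} (hx : xhat h ∈ recommendations N M) :
    xRec xhat h ∈ recommendations N M := by
  have h1 := explore_mul_le_one N (h.length + 1)
  have h0 := explore_nonneg N (h.length + 1)
  intro j
  refine ⟨fun i => ?_, ?_⟩
  · have := (hx j).1 i
    simp only [xRec]
    have : 0 ≤ (1 - (N : ℝ) * explore N (h.length + 1)) * xhat h i j :=
      mul_nonneg (by linarith) this
    linarith
  · have := (hx j).2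
    simp only at this
    simp only [xRec, Finset.sum_add_distrib, ← Finset.mul_sum, this]
    simp

lemma explore_le_xRec {h : History N M} (hx : xhat h ∈ recommendations N M) (i : Fin N)
    (j : Fin M) : explore N (h.length + 1) ≤ xRec xhat h i j := by
  have := mul_nonneg (sub_nonneg.2 (explore_mul_le_one N (h.length + 1))) ((hx j).1 i)
  simp only [xRec]; simp only at this; linarith

variable (hp : ∀ t, parr t ∈ stdSimplex ℝ (Fin M))
  (hy : ∀ i j, y i j ∈ Set.Ioo (0 : ℝ) 1) (hx : ∀ h, xhat h ∈ recommendations N M)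

include hp hy hx

lemma stepProb_nonneg (h : History N M) (o : Obs N M) : 0 ≤ stepProb parr y xhat h o := by
  unfold stepProb
  have h1 := (hp (h.length + 1)).1 o.1
  have h2 := (xRec_mem (hx h) o.1).1 o.2.1
  have h3 := hy o.2.1 o.1
  refine mul_nonneg (mul_nonneg h1 h2) ?_
  split_ifs
  · exact h3.1.le
  · linarith [h3.2]

omit hp hy hx in
lemma sum_stepProb_mul (h : History N M) (F : Obs N M → ℝ) :
    ∑ o, stepProb parr y xhat h o * F o =
      ∑ j, parr (h.length + 1) j * ∑ i, xRec xhat h i j *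
        (y i j * F (j, i, true) + (1 - y i j) * F (j, i, false)) := by
  rw [Fintype.sum_prod_type]
  refine Finset.sum_congr rfl fun j _ => ?_
  rw [Fintype.sum_prod_type, Finset.mul_sum]
  refine Finset.sum_congr rfl fun i _ => ?_
  rw [Fintype.sum_bool]
  simp only [stepProb, if_true, Bool.false_eq_true, if_false]
  ring

omit hy in
lemma sum_stepProb (h : History N M) : ∑ o, stepProb parr y xhat h o = 1 := by
  have := sum_stepProb_mul (parr := parr) (y := y) (xhat := xhat) h (fun _ => 1)
  simp only [mul_one, add_sub_cancel] at this
  rw [this]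
  have h2 : ∀ j, ∑ i, xRec xhat h i j = 1 := fun j => (xRec_mem (hx h) j).2
  simp only [h2, mul_one]
  exact (hp _).2

lemma histProb_nonneg (h : History N M) : 0 ≤ histProb parr y xhat h := by
  induction h with
  | nil => simp [histProb]
  | cons o h ih => exact mul_nonneg ih (stepProb_nonneg hp hy hx h o)

lemma expect_mono (n : ℕ) {F G : History N M → ℝ} (h : ∀ h, h.length = n → F h ≤ G h) :
    expect parr y xhat n F ≤ expect parr y xhat n G := by
  unfold expect
  refine Finset.sum_le_sum fun v _ => ?_
  exact mul_le_mul_of_nonneg_left (h _ (by simp)) (histProb_nonneg hp hy hx _)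

omit hy in
lemma expect_const (n : ℕ) (c : ℝ) : expect parr y xhat n (fun _ => c) = c := by
  induction n with
  | zero => rw [expect_zero]
  | succ n ih =>
    rw [expect_succ]
    simp only [← Finset.sum_mul, sum_stepProb hp hx, one_mul, ih]

omit hy in
-- Later rounds integrate out. Histories list the most recent round first, so dropping `m` entries
-- leaves the first `k` rounds.
lemma expect_drop (k m : ℕ) (F : History N M → ℝ) :
    expect parr y xhat (k + m) (fun h => F (h.drop m)) = expect parr y xhat k F := by
  induction m with
  | zero => simp
  | succ m ih =>
    rw [← add_assoc, expect_succ]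
    simp only [List.drop_succ_cons, ← Finset.sum_mul, sum_stepProb hp hx, one_mul, ih]

/-- Exponential moments of the increment over the last `m` rounds of an additive functional. -/
lemma expect_exp_le {S : History N M → ℝ} {X : History N M → Obs N M → ℝ}
    (hS : ∀ h o, S (o :: h) = S h + X h o) (l c : ℝ) (m k : ℕ)
    (hX : ∀ h : History N M, h.length < k + m →
      ∑ o, stepProb parr y xhat h o * Real.exp (l * X h o) ≤ Real.exp c) :
    expect parr y xhat (k + m) (fun h => Real.exp (l * (S h - S (h.drop m)))) ≤
      Real.exp (m * c) := by
  induction m with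
  | zero => simp [expect_const hp hx]
  | succ m ih =>
    rw [← add_assoc, expect_succ]
    have h1 : expect parr y xhat (k + m) (fun h => ∑ o, stepProb parr y xhat h o *
          Real.exp (l * (S (o :: h) - S ((o :: h).drop (m + 1))))) ≤
        expect parr y xhat (k + m)
          (fun h => Real.exp c * Real.exp (l * (S h - S (h.drop m)))) := by
      refine expect_mono hp hy hx _ fun h hh => ?_
      have h2 := hX h (by omega)
      calc ∑ o, stepProb parr y xhat h o *
            Real.exp (l * (S (o :: h) - S ((o :: h).drop (m + 1))))
          = (∑ o, stepProb parr y xhat h o * Real.exp (l * X h o)) *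
              Real.exp (l * (S h - S (h.drop m))) := by
            rw [Finset.sum_mul]
            refine Finset.sum_congr rfl fun o _ => ?_
            rw [hS, List.drop_succ_cons, mul_assoc, ← Real.exp_add]
            ring_nf
        _ ≤ _ := mul_le_mul_of_nonneg_right h2 (Real.exp_pos _).le
    refine h1.trans ?_
    rw [expect_const_mul]
    calc Real.exp c * _ ≤ Real.exp c * Real.exp (m * c) :=
          mul_le_mul_of_nonneg_left (ih fun h hh => hX h (by omega)) (Real.exp_pos _).le
      _ = _ := by rw [← Real.exp_add]; push_cast; ring_nf

end Expect

/-- Bernstein's argument: `exp u ≤ 1 + u + u ^ 2` for `|u| ≤ 1`, the linear term has mean zero, and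
`1 + u ≤ exp u` returns to an exponential that can be multiplied over the rounds. -/
lemma sum_mul_exp_le {ι : Type*} [Fintype ι] {q X : ι → ℝ} {l v : ℝ} (hq : ∀ o, 0 ≤ q o)
    (h1 : ∑ o, q o = 1) (h0 : ∑ o, q o * X o = 0) (hv : ∑ o, q o * X o ^ 2 ≤ v)
    (hX : ∀ o, |l * X o| ≤ 1) : ∑ o, q o * Real.exp (l * X o) ≤ Real.exp (l ^ 2 * v) := by
  have h2 : ∀ o, q o * Real.exp (l * X o) ≤ q o + l * (q o * X o) + l ^ 2 * (q o * X o ^ 2) := by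
    intro o
    have h3 := abs_le.1 (Real.abs_exp_sub_one_sub_id_le (hX o))
    have h4 : Real.exp (l * X o) ≤ 1 + l * X o + (l * X o) ^ 2 := by linarith [h3.2]
    calc _ ≤ q o * (1 + l * X o + (l * X o) ^ 2) := mul_le_mul_of_nonneg_left h4 (hq o)
      _ = _ := by ring
  calc _ ≤ ∑ o, (q o + l * (q o * X o) + l ^ 2 * (q o * X o ^ 2)) := Finset.sum_le_sum fun o _ => h2 o
    _ = 1 + l ^ 2 * ∑ o, q o * X o ^ 2 := by
      rw [Finset.sum_add_distrib, Finset.sum_add_distrib, ← Finset.mul_sum, ← Finset.mul_sum, h1, h0]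
      ring
    _ ≤ l ^ 2 * v + 1 := by nlinarith [sq_nonneg l]
    _ ≤ _ := Real.add_one_le_exp _

/-! ### Concentration of arrival counts and weighted purchases -/

section Deviations

variable {N M : ℕ} {parr : ℕ → Fin M → ℝ} {y : Fin N → Fin M → ℝ}
  {xhat : History N M → Fin N → Fin M → ℝ}

/-- Deviation of the number of arrivals of type `j` from its mean. -/
def arrivalDev (parr : ℕ → Fin M → ℝ) (j : Fin M) (h : History N M) : ℝ :=
  arrivals h j - ∑ k ∈ Finset.range h.length, parr (k + 1) j

/-- Deviation of the inverse probability weighted purchases from their conditional means. -/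
def ipwDev (y : Fin N → Fin M → ℝ) (xhat : History N M → Fin N → Fin M → ℝ) (i : Fin N)
    (j : Fin M) (h : History N M) : ℝ :=
  ipwSum xhat h i j - y i j * arrivals h j

/-- The increment of `arrivalDev`. -/
def arrivalInc (parr : ℕ → Fin M → ℝ) (j : Fin M) (h : History N M) (o : Obs N M) : ℝ :=
  (if o.1 = j then 1 else 0) - parr (h.length + 1) j

/-- The increment of `ipwDev`. -/
def ipwInc (y : Fin N → Fin M → ℝ) (xhat : History N M → Fin N → Fin M → ℝ) (i : Fin N)
    (j : Fin M) (h : History N M) (o : Obs N M) : ℝ :=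
  (if o.1 = j ∧ o.2.1 = i ∧ o.2.2 = true then 1 / xRec xhat h i j else 0) -
    y i j * if o.1 = j then 1 else 0

lemma arrivals_cons (o : Obs N M) (h : History N M) (j : Fin M) :
    (arrivals (o :: h) j : ℝ) = arrivals h j + if o.1 = j then 1 else 0 := by
  unfold arrivals
  rw [List.countP_cons]
  by_cases hj : o.1 = j <;> simp [hj]

lemma arrivalDev_cons (j : Fin M) (h : History N M) (o : Obs N M) :
    arrivalDev parr j (o :: h) = arrivalDev parr j h + arrivalInc parr j h o := by
  simp only [arrivalDev, arrivalInc, arrivals_cons, List.length_cons, Finset.sum_range_succ]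
  ring

lemma ipwDev_cons (i : Fin N) (j : Fin M) (h : History N M) (o : Obs N M) :
    ipwDev y xhat i j (o :: h) = ipwDev y xhat i j h + ipwInc y xhat i j h o := by
  simp only [ipwDev, ipwInc, arrivals_cons, ipwSum]
  ring

lemma sum_stepProb_purchase (h : History N M) (i : Fin N) (j : Fin M) (c : ℝ) :
    ∑ o, stepProb parr y xhat h o * (if o.1 = j ∧ o.2.1 = i ∧ o.2.2 = true then c else 0) =
      parr (h.length + 1) j * xRec xhat h i j * y i j * c := by
  rw [Finset.sum_eq_single (j, i, true)]
  · simp [stepProb]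
  · rintro ⟨a, b, z⟩ _ hne
    rw [if_neg, mul_zero]
    rintro ⟨h1, h2, h3⟩
    exact hne (by simp only at h1 h2 h3; rw [h1, h2, h3])
  · simp

variable (hp : ∀ t, parr t ∈ stdSimplex ℝ (Fin M))
  (hy : ∀ i j, y i j ∈ Set.Ioo (0 : ℝ) 1) (hx : ∀ h, xhat h ∈ recommendations N M)

include hx in
lemma sum_stepProb_arrival (h : History N M) (j : Fin M) :
    ∑ o, stepProb parr y xhat h o * (if o.1 = j then 1 else 0) = parr (h.length + 1) j := by
  rw [sum_stepProb_mul]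
  rw [Finset.sum_eq_single j]
  · have : ∑ i, xRec xhat h i j = 1 := (xRec_mem (hx h) j).2
    simp [this]
  · intro b _ hb; simp [hb]
  · simp

include hp in
lemma arrival_mem_Icc (t : ℕ) (j : Fin M) : parr t j ∈ Set.Icc (0 : ℝ) 1 := by
  refine ⟨(hp t).1 j, ?_⟩
  rw [← (hp t).2]
  exact Finset.single_le_sum (f := parr t) (fun i _ => (hp t).1 i) (Finset.mem_univ j)

include hp hy hx

lemma sum_stepProb_exp_arrival {l : ℝ} (hl : |l| ≤ 1) (h : History N M) (j : Fin M) :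
    ∑ o, stepProb parr y xhat h o * Real.exp (l * arrivalInc parr j h o) ≤
      Real.exp (l ^ 2 * 1) := by
  have hX : ∀ o, |arrivalInc parr j h o| ≤ 1 := by
    intro o
    have := arrival_mem_Icc hp (h.length + 1) j
    unfold arrivalInc
    rw [abs_le]
    split_ifs <;> constructor <;> linarith [this.1, this.2]
  refine sum_mul_exp_le (stepProb_nonneg hp hy hx h) (sum_stepProb hp hx h) ?_ ?_ ?_
  · simp only [arrivalInc, mul_sub, Finset.sum_sub_distrib, sum_stepProb_arrival hx,
      ← Finset.sum_mul, sum_stepProb hp hx]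
    ring
  · rw [← sum_stepProb (y := y) hp hx h]
    refine Finset.sum_le_sum fun o _ => ?_
    have h1 : arrivalInc parr j h o ^ 2 ≤ 1 := by
      rw [← sq_abs]; exact pow_le_one₀ (abs_nonneg _) (hX o)
    nlinarith [stepProb_nonneg hp hy hx h o]
  · intro o
    rw [abs_mul]
    exact mul_le_one₀ hl (abs_nonneg _) (hX o)

/-- A purchase weighted by `1 / x` is unbiased for `y`, has size at most `1 / x` and second moment
of order `1 / x`; the exploration floor `e` on `x` bounds both by `1 / e`. Using the variance, and
not the squared size `1 / e ^ 2`, is what yields the `t ^ (-1/3)` rate. -/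
lemma sum_stepProb_exp_ipw {l e : ℝ} (he : 0 < e) (hl : |l| ≤ e) (h : History N M)
    (heh : e ≤ explore N (h.length + 1)) (i : Fin N) (j : Fin M) :
    ∑ o, stepProb parr y xhat h o * Real.exp (l * ipwInc y xhat i j h o) ≤
      Real.exp (l ^ 2 * (1 / e)) := by
  have hxe : e ≤ xRec xhat h i j := heh.trans (explore_le_xRec (hx h) i j)
  have hx0 : 0 < xRec xhat h i j := he.trans_le hxe
  have hx1 : xRec xhat h i j ≤ 1 := by
    have := (xRec_mem (hx h) j)
    rw [← this.2]
    exact Finset.single_le_sum (f := fun i => xRec xhat h i j) (fun i _ => this.1 i)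
      (Finset.mem_univ i)
  have hinv : 1 / xRec xhat h i j ≤ 1 / e := one_div_le_one_div_of_le he hxe
  have hinv1 : 1 ≤ 1 / xRec xhat h i j := by rw [le_div_iff₀ hx0]; linarith
  have hyy := hy i j
  have hpp := arrival_mem_Icc hp (h.length + 1) j
  refine sum_mul_exp_le (stepProb_nonneg hp hy hx h) (sum_stepProb hp hx h) ?_ ?_ ?_
  · have : ∀ o, stepProb parr y xhat h o * ipwInc y xhat i j h o =
        stepProb parr y xhat h o * (if o.1 = j ∧ o.2.1 = i ∧ o.2.2 = true then
          1 / xRec xhat h i j else 0) -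
        y i j * (stepProb parr y xhat h o * (if o.1 = j then 1 else 0)) := by
      intro o; unfold ipwInc; ring
    simp only [this, Finset.sum_sub_distrib, ← Finset.mul_sum, sum_stepProb_arrival hx,
      sum_stepProb_purchase]
    field_simp
    ring
  -- In the expanded square, the first two terms are supported on purchases of `i` by type `j`, the
  -- last one on all arrivals of type `j`.
  · have : ∀ o, stepProb parr y xhat h o * ipwInc y xhat i j h o ^ 2 =
        stepProb parr y xhat h o * (if o.1 = j ∧ o.2.1 = i ∧ o.2.2 = true then
          ((1 / xRec xhat h i j) ^ 2 - 2 * y i j * (1 / xRec xhat h i j)) else 0) +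
        y i j ^ 2 * (stepProb parr y xhat h o * (if o.1 = j then 1 else 0)) := by
      intro o; unfold ipwInc
      by_cases h1 : o.1 = j
      · by_cases h2 : o.2.1 = i ∧ o.2.2 = true
        · simp only [h1, h2, and_self, if_true]; ring
        · simp only [h1, h2, true_and, if_true, if_false]; ring
      · simp [h1]
    simp only [this, Finset.sum_add_distrib, ← Finset.mul_sum, sum_stepProb_arrival hx,
      sum_stepProb_purchase]
    have h3 : parr (h.length + 1) j * xRec xhat h i j * y i j *
          ((1 / xRec xhat h i j) ^ 2 - 2 * y i j * (1 / xRec xhat h i j)) +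
        y i j ^ 2 * parr (h.length + 1) j =
        parr (h.length + 1) j * (y i j * (1 / xRec xhat h i j) - y i j ^ 2) := by
      field_simp; ring
    rw [h3]
    have h4 : y i j * (1 / xRec xhat h i j) - y i j ^ 2 ≤ 1 / xRec xhat h i j := by
      nlinarith [hyy.1, hyy.2, sq_nonneg (y i j)]
    have h5 : 0 ≤ y i j * (1 / xRec xhat h i j) - y i j ^ 2 := by
      nlinarith [hyy.1, hyy.2]
    nlinarith [hpp.1, hpp.2]
  · intro o
    have h1 : |ipwInc y xhat i j h o| ≤ 1 / e := by
      unfold ipwInc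
      rw [abs_le]
      split_ifs <;> constructor <;> linarith [hyy.1, hyy.2]
    rw [abs_mul]
    calc |l| * |ipwInc y xhat i j h o| ≤ e * (1 / e) := by gcongr
      _ = 1 := by field_simp

omit hp hy hx in
lemma explore_anti (N : ℕ) {s t : ℕ} (hs : 1 ≤ s) (hst : s ≤ t) : explore N t ≤ explore N s := by
  unfold explore
  refine min_le_min le_rfl (mul_le_mul_of_nonneg_left ?_ (by positivity))
  exact Real.rpow_le_rpow_of_nonpos (by positivity) (by exact_mod_cast hst) (by norm_num)

/-- Concentration of all estimates after the history `h`, with window `w` and confidence level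
`a` in units of standard deviations. -/
def Concentrated (parr : ℕ → Fin M → ℝ) (y : Fin N → Fin M → ℝ)
    (xhat : History N M → Fin N → Fin M → ℝ) (w : ℕ) (a : ℝ) (h : History N M) : Prop :=
  (∀ i j, |Real.sqrt (explore N h.length / h.length) * ipwDev y xhat i j h| ≤ a) ∧
  (∀ j, |1 / Real.sqrt h.length * arrivalDev parr j h| ≤ a) ∧
  ∀ j, |1 / Real.sqrt (min h.length w : ℕ) *
    (arrivalDev parr j h - arrivalDev parr j (h.drop w))| ≤ a

omit hp hy hx in
-- Chernoff's trick for both tails: on the bad event the indicator is dominated by a sum of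
-- exponentials.
lemma one_le_exp_of_not_abs_le {u a : ℝ} (h : ¬ |u| ≤ a) :
    1 ≤ Real.exp (-a) * (Real.exp u + Real.exp (-u)) := by
  rw [mul_add, ← Real.exp_add, ← Real.exp_add]
  push Not at h
  rcases lt_abs.1 h with h | h
  · have : (1 : ℝ) ≤ Real.exp (-a + u) := Real.one_le_exp (by linarith)
    linarith [Real.exp_pos (-a + -u)]
  · have : (1 : ℝ) ≤ Real.exp (-a + -u) := Real.one_le_exp (by linarith)
    linarith [Real.exp_pos (-a + u)]

omit hp hy hx in
lemma drop_min_length (h : History N M) (w : ℕ) : h.drop (min h.length w) = h.drop w := by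
  rcases le_total h.length w with hw | hw
  · rw [min_eq_left hw, List.drop_length, List.drop_eq_nil_of_le hw]
  · rw [min_eq_right hw]

/-- The scale `1 / √m` makes the total exponent of `m` rounds equal to `1`, and `e ≤ 3`. The case `m
= k` covers the whole history, smaller `m` the sliding window. -/
lemma expect_exp_arrival_le {k m : ℕ} (hm : 1 ≤ m) (hmk : m ≤ k) (j : Fin M) {s : ℝ}
    (hs : |s| = 1) :
    expect parr y xhat k (fun h => Real.exp (s * (1 / Real.sqrt m *
      (arrivalDev parr j h - arrivalDev parr j (h.drop m))))) ≤ 3 := by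
  obtain ⟨n, rfl⟩ := Nat.exists_eq_add_of_le' hmk
  have hm' : (1 : ℝ) ≤ m := by exact_mod_cast hm
  have h1 : (1 : ℝ) ≤ Real.sqrt m := Real.one_le_sqrt.2 hm'
  have hl : |s * (1 / Real.sqrt m)| ≤ 1 := by
    rw [abs_mul, hs, one_mul, abs_of_nonneg (by positivity), div_le_one (by positivity)]
    exact h1
  have := expect_exp_le hp hy hx (S := arrivalDev parr j) (arrivalDev_cons j)
    (s * (1 / Real.sqrt m)) _ m n (fun h _ => sum_stepProb_exp_arrival hp hy hx hl h j)
  simp only [mul_assoc] at this ⊢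
  refine this.trans ?_
  have h2 : (m : ℝ) * ((s * (1 / Real.sqrt m)) ^ 2 * 1) = 1 := by
    rw [mul_pow, ← sq_abs s, hs, div_pow, Real.sq_sqrt (by positivity)]
    field_simp
  rw [h2]
  linarith [Real.exp_one_lt_d9]

/-- The scale `√(ε_k / k)` normalizes the total variance `k / ε_k` to `1`. The Bernstein bound needs
this scale to be at most `ε_k`, which is exactly `1 ≤ k ε_k`. Since `ε` is nonincreasing, `ε_k` is a
floor for all earlier rounds. -/
lemma expect_exp_ipw_le {k : ℕ} (hk : 1 ≤ k) (hke : 1 ≤ k * explore N k) (i : Fin N) (j : Fin M)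
    {s : ℝ} (hs : |s| = 1) :
    expect parr y xhat k (fun h => Real.exp (s * (Real.sqrt (explore N k / k) *
      ipwDev y xhat i j h))) ≤ 3 := by
  have hk' : (1 : ℝ) ≤ k := by exact_mod_cast hk
  have he : 0 < explore N k := by
    by_contra hcon
    have : (k : ℝ) * explore N k ≤ 0 := mul_nonpos_of_nonneg_of_nonpos (by positivity)
      (not_lt.1 hcon)
    linarith
  have hl : |s * Real.sqrt (explore N k / k)| ≤ explore N k := by
    rw [abs_mul, hs, one_mul, abs_of_nonneg (by positivity), Real.sqrt_le_left he.le,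
      div_le_iff₀ (by positivity)]
    nlinarith
  have := expect_exp_le hp hy hx (S := ipwDev y xhat i j) (ipwDev_cons i j)
    (s * Real.sqrt (explore N k / k)) _ k 0
    (fun h hh => sum_stepProb_exp_ipw hp hy hx he hl h
      (explore_anti N (by omega) (by omega)) i j)
  rw [zero_add] at this
  have h0 : expect parr y xhat k (fun h => Real.exp (s * (Real.sqrt (explore N k / k) *
      ipwDev y xhat i j h))) = expect parr y xhat k (fun h => Real.exp (s *
        Real.sqrt (explore N k / k) * (ipwDev y xhat i j h - ipwDev y xhat i j (h.drop k)))) := by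
    refine expect_congr _ fun h hh => ?_
    rw [← hh, List.drop_length]
    simp [ipwDev, ipwSum, arrivals, mul_assoc]
  rw [h0]
  refine this.trans ?_
  have h2 : (k : ℝ) * ((s * Real.sqrt (explore N k / k)) ^ 2 * (1 / explore N k)) = 1 := by
    rw [mul_pow, ← sq_abs s, hs, Real.sq_sqrt (by positivity)]
    field_simp
  rw [h2]
  linarith [Real.exp_one_lt_d9]

open Classical in
-- Union bound: each two-sided deviation contributes `3 + 3`; there are `N M` deviations of
-- purchases and two kinds of arrival deviation for each of the `M` types.
lemma expect_not_concentrated_le {k w : ℕ} (hk : 1 ≤ k) (hw : 1 ≤ w)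
    (hke : 1 ≤ k * explore N k) (a : ℝ) :
    expect parr y xhat k (fun h => if Concentrated parr y xhat w a h then 0 else 1) ≤
      (6 * N * M + 12 * M) * Real.exp (-a) := by
  set G1 : Fin N → Fin M → ℝ → History N M → ℝ := fun i j s h =>
    Real.exp (s * (Real.sqrt (explore N k / k) * ipwDev y xhat i j h)) with hG1
  set G2 : ℕ → Fin M → ℝ → History N M → ℝ := fun m j s h =>
    Real.exp (s * (1 / Real.sqrt m * (arrivalDev parr j h - arrivalDev parr j (h.drop m))))
    with hG2
  have key : ∀ h : History N M, h.length = k →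
      (if Concentrated parr y xhat w a h then (0 : ℝ) else 1) ≤
        Real.exp (-a) * (∑ i, ∑ j, (G1 i j 1 h + G1 i j (-1) h) +
          (∑ j, (G2 k j 1 h + G2 k j (-1) h) +
            ∑ j, (G2 (min k w) j 1 h + G2 (min k w) j (-1) h))) := by
    intro h hh
    have p1 : 0 ≤ ∑ i, ∑ j, (G1 i j 1 h + G1 i j (-1) h) := by positivity
    have p2 : ∀ m, 0 ≤ ∑ j, (G2 m j 1 h + G2 m j (-1) h) := fun m => by positivity
    have hea := Real.exp_pos (-a)
    split_ifs with hc
    · have := p2 k; have := p2 (min k w); positivity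
    · unfold Concentrated at hc
      simp only [not_and_or, not_forall] at hc
      rcases hc with ⟨i, j, hc⟩ | ⟨j, hc⟩ | ⟨j, hc⟩
      · refine (one_le_exp_of_not_abs_le hc).trans (mul_le_mul_of_nonneg_left ?_ hea.le)
        have h1 : G1 i j 1 h + G1 i j (-1) h ≤ ∑ i, ∑ j, (G1 i j 1 h + G1 i j (-1) h) :=
          (Finset.single_le_sum (f := fun j => G1 i j 1 h + G1 i j (-1) h)
            (fun j _ => by positivity) (Finset.mem_univ j)).trans
          (Finset.single_le_sum (f := fun i => ∑ j, (G1 i j 1 h + G1 i j (-1) h))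
            (fun i _ => by positivity) (Finset.mem_univ i))
        have := p2 k; have := p2 (min k w)
        simp only [hG1, one_mul, neg_one_mul] at h1 ⊢
        rw [hh]
        linarith
      · refine (one_le_exp_of_not_abs_le hc).trans (mul_le_mul_of_nonneg_left ?_ hea.le)
        have h1 := Finset.single_le_sum (f := fun j => G2 k j 1 h + G2 k j (-1) h)
            (fun j _ => by positivity) (Finset.mem_univ j)
        -- The deviation from the start is the increment over the last `k` rounds, since nothing
        -- remains after dropping them.
        have h0 : arrivalDev parr j ([] : History N M) = 0 := by simp [arrivalDev, arrivals]
        have h2 : h.drop k = [] := by rw [← hh, List.drop_length]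
        have := p2 (min k w)
        simp only [hG2, one_mul, neg_one_mul, h2, h0, sub_zero] at h1 this ⊢
        rw [hh]
        linarith
      · refine (one_le_exp_of_not_abs_le hc).trans (mul_le_mul_of_nonneg_left ?_ hea.le)
        have h1 := Finset.single_le_sum
          (f := fun j => G2 (min k w) j 1 h + G2 (min k w) j (-1) h)
            (fun j _ => by positivity) (Finset.mem_univ j)
        have h2 : h.drop (min k w) = h.drop w := by rw [← hh, drop_min_length]
        have := p2 k
        simp only [hG2, one_mul, neg_one_mul, h2] at h1 this ⊢
        rw [hh]
        linarith
  refine (expect_mono hp hy hx k key).trans ?_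
  rw [expect_const_mul, mul_comm]
  refine mul_le_mul_of_nonneg_right ?_ (Real.exp_pos _).le
  simp only [expect_add, expect_sum]
  have b1 : ∀ i j s, |s| = 1 → expect parr y xhat k (G1 i j s) ≤ 3 := fun i j s hs =>
    expect_exp_ipw_le hp hy hx hk hke i j hs
  have b2 : ∀ m j s, 1 ≤ m → m ≤ k → |s| = 1 → expect parr y xhat k (G2 m j s) ≤ 3 :=
    fun m j s hm hmk hs => expect_exp_arrival_le hp hy hx hm hmk j hs
  have e1 : |(1 : ℝ)| = 1 := abs_one
  have e2 : |(-1 : ℝ)| = 1 := by simp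
  have s1 : ∑ i : Fin N, ∑ j : Fin M, (expect parr y xhat k (G1 i j 1) +
      expect parr y xhat k (G1 i j (-1))) ≤ ∑ i : Fin N, ∑ j : Fin M, (6 : ℝ) :=
    Finset.sum_le_sum fun i _ => Finset.sum_le_sum fun j _ => by
      linarith [b1 i j 1 e1, b1 i j (-1) e2]
  have s2 : ∀ m, 1 ≤ m → m ≤ k → ∑ j : Fin M, (expect parr y xhat k (G2 m j 1) +
      expect parr y xhat k (G2 m j (-1))) ≤ ∑ j : Fin M, (6 : ℝ) := fun m hm hmk =>
    Finset.sum_le_sum fun j _ => by linarith [b2 m j 1 hm hmk e1, b2 m j (-1) hm hmk e2]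
  have t1 := s2 k hk le_rfl
  have t2 := s2 (min k w) (le_min hk hw) (min_le_left _ _)
  simp only [Finset.sum_const, Finset.card_univ, Fintype.card_fin, nsmul_eq_mul] at s1 t1 t2
  linarith

end Deviations

/-! ### Polytopes and Hoffman's error bound -/

/-- A polyhedron has finitely many extreme points. -/
lemma finite_extremePoints_polyhedron {E κ : Type*} [AddCommGroup E] [Module ℝ E] [Finite κ]
    (g : κ → E →ₗ[ℝ] ℝ) (b : κ → ℝ) :
    (Set.extremePoints ℝ {x : E | ∀ k, g k x ≤ b k}).Finite := by
  -- An extreme point is determined by its set of active constraints. If `v` and `v'` share it, then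
  -- `v ± e (v - v')` satisfies every constraint for small `e > 0`: active ones are constant along
  -- the line, the others have slack. Extremality forces `v = v'`.
  refine Set.Finite.of_injOn (f := fun v => {k | g k v = b k}) (t := Set.univ)
    (Set.mapsTo_univ _ _) ?_ Set.finite_univ
  intro v hv v' hv' hvv
  have hact : ∀ k, g k v = b k ↔ g k v' = b k := fun k => by
    have := congrArg (fun s => k ∈ s) hvv
    simpa using this
  have hev : ∀ c : ℝ, ∀ᶠ e in nhds (0 : ℝ), ∀ k, g k (v + (c * e) • (v - v')) ≤ b k := by
    intro c
    rw [Filter.eventually_all]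
    intro k
    rcases (hv.1 k).eq_or_lt with hk | hk
    · filter_upwards with e
      simp [(hact k).1 hk, hk]
    · have hcont : Continuous fun e : ℝ => g k v + (c * e) * g k (v - v') := by fun_prop
      have := hcont.tendsto 0
      simp only [mul_zero, zero_mul, add_zero] at this
      filter_upwards [this.eventually_lt_const hk] with e he
      rw [map_add, map_smul, smul_eq_mul]
      exact he.le
  obtain ⟨e, ⟨he1, he2⟩, he0⟩ := (((hev 1).and (hev (-1))).filter_mono
    nhdsWithin_le_nhds |>.and self_mem_nhdsWithin :
      ∀ᶠ e in nhdsWithin (0 : ℝ) (Set.Ioi 0), _).exists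
  have hmem : v ∈ openSegment ℝ (v + (1 * e) • (v - v')) (v + (-1 * e) • (v - v')) := by
    refine ⟨1 / 2, 1 / 2, by norm_num, by norm_num, by norm_num, ?_⟩
    module
  have h1 := hv.2 he1 he2 hmem
  have h2 : (1 * e) • (v - v') = 0 := by simpa using h1
  rcases smul_eq_zero.1 h2 with h3 | h3
  · simp only [one_mul] at h3; exact absurd h3 (ne_of_gt he0)
  · exact sub_eq_zero.1 h3

/-- A compact polyhedron is the convex hull of its finitely many extreme points. -/
lemma convexHull_extremePoints_polytope {E κ : Type*} [NormedAddCommGroup E] [NormedSpace ℝ E]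
    [Finite κ] (g : κ → E →ₗ[ℝ] ℝ) (b : κ → ℝ) (hP : IsCompact {x : E | ∀ k, g k x ≤ b k}) :
    convexHull ℝ (Set.extremePoints ℝ {x : E | ∀ k, g k x ≤ b k}) =
      {x : E | ∀ k, g k x ≤ b k} := by
  have hconv : Convex ℝ {x : E | ∀ k, g k x ≤ b k} := by
    rw [Set.ofPred_forall]
    exact convex_iInter fun k => convex_halfSpace_le (g k).isLinear _
  -- Krein–Milman; the closure is superfluous because the hull of a finite set is compact.
  have h := closure_convexHull_extremePoints hP hconv
  rwa [((finite_extremePoints_polyhedron g b).isCompact_convexHull (𝕜 := ℝ)).isClosed.closure_eq] at h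

/-- Hoffman's error bound on a polytope: a point that violates a consistent system of linear
inequalities by at most `s` is within `K * s` of a solution. -/
lemma exists_hoffman_bound {E κ ι : Type*} [NormedAddCommGroup E] [NormedSpace ℝ E]
    [Finite κ] [Finite ι] (g : κ → E →ₗ[ℝ] ℝ) (b : κ → ℝ)
    (hP : IsCompact {x : E | ∀ k, g k x ≤ b k}) (a : ι → E →L[ℝ] ℝ) (β : ι → ℝ)
    (hne : ∃ x, (∀ k, g k x ≤ b k) ∧ ∀ i, a i x ≤ β i) :
    ∃ K : ℝ, 0 ≤ K ∧ ∀ x s, (∀ k, g k x ≤ b k) → 0 ≤ s → (∀ i, a i x ≤ β i + s) →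
      ∃ z, (∀ k, g k z ≤ b k) ∧ (∀ i, a i z ≤ β i) ∧ ‖x - z‖ ≤ K * s := by
  obtain ⟨z₀, hz₀, hz₀'⟩ := hne
  obtain ⟨D, hD⟩ := Metric.isBounded_iff.1 hP.isBounded
  have hD0 : 0 ≤ D := dist_nonneg.trans (hD hz₀ hz₀)
  -- The amount of violation becomes an additional coordinate in `[0, 1]`. The pairs of a point and
  -- an admissible violation form a compact polytope, which is the hull of finitely many vertices.
  let g' : κ ⊕ ι ⊕ Bool → (E × ℝ) →ₗ[ℝ] ℝ := Sum.elim (fun k => g k ∘ₗ LinearMap.fst ℝ E ℝ)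
    (Sum.elim (fun i => (a i : E →ₗ[ℝ] ℝ) ∘ₗ LinearMap.fst ℝ E ℝ - LinearMap.snd ℝ E ℝ)
      (fun c => if c then LinearMap.snd ℝ E ℝ else -LinearMap.snd ℝ E ℝ))
  let b' : κ ⊕ ι ⊕ Bool → ℝ := Sum.elim b (Sum.elim β (fun c => if c then 1 else 0))
  have hset : {p : E × ℝ | ∀ k, g' k p ≤ b' k} = {p : E × ℝ | (∀ k, g k p.1 ≤ b k) ∧
      (∀ i, a i p.1 ≤ β i + p.2) ∧ 0 ≤ p.2 ∧ p.2 ≤ 1} := by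
    ext p
    simp only [g', b', Set.mem_ofPred_eq, Sum.forall, Bool.forall_bool, Sum.elim_inl, Sum.elim_inr,
      LinearMap.comp_apply, LinearMap.fst_apply, LinearMap.sub_apply, LinearMap.snd_apply,
      ContinuousLinearMap.coe_coe, if_true, Bool.false_eq_true, if_false, LinearMap.neg_apply,
      Left.neg_nonpos_iff, sub_le_iff_le_add]
  have hcomp : IsCompact {p : E × ℝ | ∀ k, g' k p ≤ b' k} := by
    refine (hP.prod (isCompact_Icc (a := (0 : ℝ)) (b := 1))).of_isClosed_subset ?_ ?_
    · have : {p : E × ℝ | ∀ k, g' k p ≤ b' k} = ({x : E | ∀ k, g k x ≤ b k} ×ˢ Set.Icc 0 1) ∩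
          ⋂ i, {p : E × ℝ | a i p.1 ≤ β i + p.2} := by
        rw [hset]; ext p
        simp only [Set.mem_ofPred_eq, Set.mem_inter_iff, Set.mem_prod, Set.mem_Icc, Set.mem_iInter]
        tauto
      rw [this]
      refine (hP.isClosed.prod isClosed_Icc).inter (isClosed_iInter fun i => ?_)
      exact isClosed_le (by fun_prop) (by fun_prop)
    · rw [hset]; rintro p ⟨h1, -, h3, h4⟩; exact ⟨h1, h3, h4⟩
  have hfin := finite_extremePoints_polyhedron g' b'
  have hhull := convexHull_extremePoints_polytope g' b' hcomp
  set V := Set.extremePoints ℝ {p : E × ℝ | ∀ k, g' k p ≤ b' k} with hV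
  have hVsub : V ⊆ {p : E × ℝ | ∀ k, g' k p ≤ b' k} := extremePoints_subset
  rw [hset] at hVsub hhull
  -- `m` is a positive lower bound for the violations of those vertices that have a positive one.
  -- For violations of at least `m` the fixed solution `z₀` is close enough, with `K = D / m` and
  -- `D` a bound on the diameter.
  obtain ⟨m, hm0, hm1, hm⟩ : ∃ m : ℝ, 0 < m ∧ m ≤ 1 ∧ ∀ v ∈ V, 0 < v.2 → m ≤ v.2 := by
    have hev : ∀ᶠ m in nhdsWithin (0 : ℝ) (Set.Ioi 0), ∀ v ∈ V, 0 < v.2 → m ≤ v.2 := by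
      rw [Filter.eventually_all_finite hfin]
      intro v _
      by_cases hv : 0 < v.2
      · filter_upwards [nhdsWithin_le_nhds (Iio_mem_nhds hv)] with m hm _ using le_of_lt hm
      · filter_upwards with m h using absurd h hv
    obtain ⟨m, ⟨h1, h2⟩, h3⟩ := ((hev.and (nhdsWithin_le_nhds (Iio_mem_nhds one_pos))).and
      self_mem_nhdsWithin).exists
    exact ⟨m, h3, le_of_lt h2, h1⟩
  refine ⟨D / m, by positivity, ?_⟩
  have hfar : ∀ x s, (∀ k, g k x ≤ b k) → m ≤ s → ‖x - z₀‖ ≤ D / m * s := by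
    intro x s hx hs
    rw [← dist_eq_norm]
    refine (hD hx hz₀).trans ?_
    rw [div_mul_eq_mul_div, le_div_iff₀ hm0]
    gcongr
  intro x s hx hs hxs
  rcases le_total m s with hms | hms
  · exact ⟨z₀, hz₀, hz₀', hfar x s hx hms⟩
  -- The pairs for which the claim holds form a convex set. It contains every vertex (violation
  -- zero: the vertex itself is a solution; otherwise `z₀` serves), hence the whole polytope.
  let C : Set (E × ℝ) := {p | ∃ z, (∀ k, g k z ≤ b k) ∧ (∀ i, a i z ≤ β i) ∧
    ‖p.1 - z‖ ≤ D / m * p.2}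
  have hC : Convex ℝ C := by
    rintro p ⟨z, h1, h2, h3⟩ p' ⟨z', h1', h2', h3'⟩ u v hu hv huv
    refine ⟨u • z + v • z', fun k => ?_, fun i => ?_, ?_⟩
    · simp only [map_add, map_smul, smul_eq_mul]
      have hb : b k = u * b k + v * b k := by rw [← add_mul, huv, one_mul]
      linarith [mul_le_mul_of_nonneg_left (h1 k) hu, mul_le_mul_of_nonneg_left (h1' k) hv]
    · simp only [map_add, map_smul, smul_eq_mul]
      have hb : β i = u * β i + v * β i := by rw [← add_mul, huv, one_mul]
      linarith [mul_le_mul_of_nonneg_left (h2 i) hu, mul_le_mul_of_nonneg_left (h2' i) hv]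
    · have : (u • p + v • p').1 - (u • z + v • z') = u • (p.1 - z) + v • (p'.1 - z') := by
        simp only [Prod.fst_add, Prod.smul_fst]; module
      rw [this]
      refine (norm_add_le _ _).trans ?_
      rw [norm_smul, norm_smul, Real.norm_of_nonneg hu, Real.norm_of_nonneg hv]
      simp only [Prod.snd_add, Prod.smul_snd, smul_eq_mul]
      nlinarith [mul_le_mul_of_nonneg_left h3 hu, mul_le_mul_of_nonneg_left h3' hv]
  have hVC : V ⊆ C := by
    intro v hv
    obtain ⟨h1, h2, h3, -⟩ := hVsub hv
    rcases h3.eq_or_lt with h4 | h4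
    · exact ⟨v.1, h1, fun i => by simpa [← h4] using h2 i, by simp [← h4]⟩
    · exact ⟨z₀, hz₀, hz₀', hfar v.1 v.2 h1 (hm v hv h4)⟩
  have hmem : (x, s) ∈ convexHull ℝ V := by
    rw [hhull]; exact ⟨hx, hxs, hs, hms.trans hm1⟩
  exact convexHull_min hVC hC hmem

/-- If a system of linear inequalities is inconsistent on a compact set, so is a small relaxation
of it. -/
lemma exists_relaxation_infeasible {E ι : Type*} [TopologicalSpace E] [T2Space E] {P : Set E}
    (hP : IsCompact P) (a : ι → E → ℝ) (ha : ∀ i, Continuous (a i)) (β : ι → ℝ)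
    (hne : ¬ ∃ x ∈ P, ∀ i, a i x ≤ β i) :
    ∃ s : ℝ, 0 < s ∧ ¬ ∃ x ∈ P, ∀ i, a i x ≤ β i + s := by
  by_contra! hcon
  apply hne
  -- If all relaxations were consistent, these nested nonempty compact sets would have a common
  -- point, which solves the original system.
  let t : ℕ → Set E := fun n => {x ∈ P | ∀ i, a i x ≤ β i + 1 / ((n : ℝ) + 1)}
  have hcl : ∀ n, IsCompact (t n) := fun n => by
    have : t n = P ∩ ⋂ i, {x | a i x ≤ β i + 1 / ((n : ℝ) + 1)} := by
      ext x; simp [t]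
    rw [this]
    exact hP.inter_right (isClosed_iInter fun i => isClosed_le (ha i) continuous_const)
  have hanti : ∀ n, t (n + 1) ⊆ t n := by
    rintro n x ⟨h1, h2⟩
    refine ⟨h1, fun i => (h2 i).trans ?_⟩
    have : 1 / (((n + 1 : ℕ) : ℝ) + 1) ≤ 1 / ((n : ℝ) + 1) := by
      apply one_div_le_one_div_of_le (by positivity); push_cast; linarith
    linarith
  have hnon : ∀ n, (t n).Nonempty := fun n => hcon _ (by positivity)
  obtain ⟨x, hx⟩ := IsCompact.nonempty_iInter_of_sequence_nonempty_isCompact_isClosed t hanti hnon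
    (hcl 0) fun n => (hcl n).isClosed
  rw [Set.mem_iInter] at hx
  refine ⟨x, (hx 0).1, fun i => le_of_forall_pos_le_add fun e he => ?_⟩
  obtain ⟨n, hn⟩ := exists_nat_one_div_lt he
  linarith [(hx n).2 i]

/-! ### Sensitivity of the fair recommendation problem -/

section Deterministic

variable {N M : ℕ}

lemma abs_entry_le_norm (A : Fin N → Fin M → ℝ) (i : Fin N) (j : Fin M) : |A i j| ≤ ‖A‖ :=
  (norm_le_pi_norm (A i) j).trans (norm_le_pi_norm A i)

lemma abs_entry_sub_le (A A' : Fin N → Fin M → ℝ) (i : Fin N) (j : Fin M) :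
    |A i j - A' i j| ≤ ‖A - A'‖ :=
  abs_entry_le_norm (A - A') i j

lemma recommendations_mem_Icc {x : Fin N → Fin M → ℝ} (hx : x ∈ recommendations N M) (i : Fin N)
    (j : Fin M) : x i j ∈ Set.Icc (0 : ℝ) 1 := by
  refine ⟨(hx j).1 i, ?_⟩
  rw [← (hx j).2]
  exact Finset.single_le_sum (f := fun i => x i j) (fun i _ => (hx j).1 i) (Finset.mem_univ i)

lemma recommendations_abs_le {x : Fin N → Fin M → ℝ} (hx : x ∈ recommendations N M) (i : Fin N)
    (j : Fin M) : |x i j| ≤ 1 := by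
  have := recommendations_mem_Icc hx i j
  rw [abs_of_nonneg this.1]; exact this.2

/-- Violation of the fairness constraint of an item or of a user type. -/
def violation (S : Spec N M) (θ : Instance N M) (x : Fin N → Fin M → ℝ) : Fin N ⊕ Fin M → ℝ :=
  Sum.elim (fun i => S.δI * itemOutcome (S.L θ) (S.fI θ) i - itemOutcome (S.L θ) x i)
    (fun j => S.δU * userOutcome (S.U θ) (S.fU θ) j - userOutcome (S.U θ) x j)

lemma mem_feasible_iff (S : Spec N M) (θ : Instance N M) (η : ℝ) (x : Fin N → Fin M → ℝ) :
    x ∈ S.feasible θ η ↔ x ∈ recommendations N M ∧ ∀ k, violation S θ x k ≤ η := by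
  simp only [Spec.feasible, Set.mem_ofPred_eq, violation, Sum.forall, Sum.elim_inl, Sum.elim_inr,
    tsub_le_iff_right, add_comm η]

lemma abs_itemOutcome_sub_le (L L' x x' : Fin N → Fin M → ℝ) {a b : ℝ}
    (ha : ∀ i j, |L i j * x i j - L' i j * x' i j| ≤ a + b) (i : Fin N) :
    |itemOutcome L x i - itemOutcome L' x' i| ≤ M * (a + b) := by
  unfold itemOutcome
  rw [← Finset.sum_sub_distrib]
  refine (Finset.abs_sum_le_sum_abs _ _).trans ?_
  refine (Finset.sum_le_sum fun j _ => ha i j).trans ?_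
  simp [mul_add]

lemma abs_userOutcome_sub_le (U U' x x' : Fin N → Fin M → ℝ) {a b : ℝ}
    (ha : ∀ i j, |U i j * x i j - U' i j * x' i j| ≤ a + b) (j : Fin M) :
    |userOutcome U x j - userOutcome U' x' j| ≤ N * (a + b) := by
  unfold userOutcome
  rw [← Finset.sum_sub_distrib]
  refine (Finset.abs_sum_le_sum_abs _ _).trans ?_
  refine (Finset.sum_le_sum fun i _ => ha i j).trans ?_
  simp [mul_add]

/-- The user-fair outcome is a column maximum of `U`, and a maximum is as Lipschitz as its entries.
This is why no continuity of `f^U` is assumed, although `f^U` itself can jump. -/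
lemma userOutcome_userFair {U f : Fin N → Fin M → ℝ} (h : IsUserFair U f) (j : Fin M) :
    ∃ i, userOutcome U f j = U i j ∧ ∀ i', U i' j ≤ U i j := by
  obtain ⟨best, h1, h2⟩ := h
  refine ⟨best j, ?_, fun i' => h1 i' j⟩
  simp [userOutcome, h2]

lemma abs_mul_sub_mul_le {a a' x x' : ℝ} (hx : |x'| ≤ 1) :
    |a * x - a' * x'| ≤ |a - a'| + |a| * |x - x'| := by
  have : a * x - a' * x' = (a - a') * x' + a * (x - x') := by ring
  rw [this]
  refine (abs_add_le _ _).trans ?_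
  rw [abs_mul, abs_mul]
  have := mul_le_mul_of_nonneg_left hx (abs_nonneg (a - a'))
  linarith

/-- The violations are locally Lipschitz in the instance, uniformly in the recommendations. -/
lemma exists_violation_lipschitz {S : Spec N M} (hS : S.Valid) {θ₀ : Instance N M}
    (hθ₀ : θ₀ ∈ instances N M) (hL : S.LocallyLipschitzAt θ₀) :
    ∃ K ζ : ℝ, 0 ≤ K ∧ 0 < ζ ∧ ∀ θ ∈ instances N M, ‖θ - θ₀‖ ≤ ζ →
      ∀ x ∈ recommendations N M, ∀ k,
        |violation S θ x k - violation S θ₀ x k| ≤ K * ‖θ - θ₀‖ := by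
  obtain ⟨B, ζ, hB, hζ, hLip⟩ := hL
  obtain ⟨hI, hU, hδI, hδU⟩ := hS
  -- The first summand comes from the target outcome of an item, where both `L` and `f^I` vary; the
  -- second from its outcome at `x`; the third from target and outcome of a user type.
  refine ⟨M * (B + ‖S.L θ₀‖ * B) + M * B + (1 + N) * B, ζ, by positivity, hζ, ?_⟩
  intro θ hθ hd x hx k
  obtain ⟨l1, l2, l3⟩ := hLip θ hθ hd
  rw [norm_sub_rev θ₀ θ] at l1 l2 l3
  set e := ‖θ - θ₀‖ with he
  have he0 : 0 ≤ e := norm_nonneg _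
  have hLx : ∀ i j, |S.L θ₀ i j * x i j - S.L θ i j * x i j| ≤ B * e + 0 := fun i j => by
    refine (abs_mul_sub_mul_le (recommendations_abs_le hx i j)).trans ?_
    rw [sub_self, abs_zero, mul_zero]
    linarith [abs_entry_sub_le (S.L θ₀) (S.L θ) i j]
  have hUx : ∀ i j, |S.U θ₀ i j * x i j - S.U θ i j * x i j| ≤ B * e + 0 := fun i j => by
    refine (abs_mul_sub_mul_le (recommendations_abs_le hx i j)).trans ?_
    rw [sub_self, abs_zero, mul_zero]
    linarith [abs_entry_sub_le (S.U θ₀) (S.U θ) i j]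
  have hMB : (0 : ℝ) ≤ M * (B * e) := by positivity
  have hNB : (0 : ℝ) ≤ N * (B * e) := by positivity
  have hMA : (0 : ℝ) ≤ M * (B * e + ‖S.L θ₀‖ * (B * e)) := by positivity
  have hBe : 0 ≤ B * e := by positivity
  rcases k with i | j
  · have h1 := abs_le.1 (abs_itemOutcome_sub_le _ _ _ _ hLx i)
    have hf : ∀ i j, |S.L θ₀ i j * S.fI θ₀ i j - S.L θ i j * S.fI θ i j| ≤
        B * e + ‖S.L θ₀‖ * (B * e) := fun i j => by
      refine (abs_mul_sub_mul_le (recommendations_abs_le (hI θ hθ).1 i j)).trans ?_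
      have t1 := (abs_entry_sub_le (S.L θ₀) (S.L θ) i j).trans l1
      have t2 := (abs_entry_sub_le (S.fI θ₀) (S.fI θ) i j).trans l3
      have t3 := mul_le_mul (abs_entry_le_norm (S.L θ₀) i j) t2 (abs_nonneg _) (norm_nonneg _)
      linarith
    have h2 := abs_itemOutcome_sub_le _ _ _ _ hf i
    have h3 : |S.δI * (itemOutcome (S.L θ₀) (S.fI θ₀) i - itemOutcome (S.L θ) (S.fI θ) i)| ≤
        M * (B * e + ‖S.L θ₀‖ * (B * e)) := by
      rw [abs_mul, abs_of_nonneg hδI.1]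
      exact (mul_le_of_le_one_left (abs_nonneg _) hδI.2).trans h2
    have h3 := abs_le.1 h3
    simp only [violation, Sum.elim_inl]
    rw [abs_le]
    constructor <;> nlinarith [h1.1, h1.2, h3.1, h3.2]
  · have h1 := abs_le.1 (abs_userOutcome_sub_le _ _ _ _ hUx j)
    have h2 : |userOutcome (S.U θ₀) (S.fU θ₀) j - userOutcome (S.U θ) (S.fU θ) j| ≤ B * e := by
      obtain ⟨b₀, e₀, m₀⟩ := userOutcome_userFair (hU θ₀ hθ₀) j
      obtain ⟨b, e1, m1⟩ := userOutcome_userFair (hU θ hθ) j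
      have t1 := abs_le.1 ((abs_entry_sub_le (S.U θ₀) (S.U θ) b₀ j).trans l2)
      have t2 := abs_le.1 ((abs_entry_sub_le (S.U θ₀) (S.U θ) b j).trans l2)
      rw [e₀, e1, abs_le]
      constructor <;> linarith [m₀ b, m1 b₀, t1.1, t1.2, t2.1, t2.2]
    have h3 : |S.δU * (userOutcome (S.U θ₀) (S.fU θ₀) j - userOutcome (S.U θ) (S.fU θ) j)| ≤
        B * e := by
      rw [abs_mul, abs_of_nonneg hδU.1]
      exact (mul_le_of_le_one_left (abs_nonneg _) hδU.2).trans h2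
    have h3 := abs_le.1 h3
    simp only [violation, Sum.elim_inr]
    rw [abs_le]
    constructor <;> nlinarith [h1.1, h1.2, h3.1, h3.2]

/-- The violations are Lipschitz in the recommendations. -/
lemma abs_violation_sub_le (S : Spec N M) (θ : Instance N M) {x x' : Fin N → Fin M → ℝ} {b : ℝ}
    (hb0 : 0 ≤ b) (hb : ∀ i j, |x i j - x' i j| ≤ b) (k : Fin N ⊕ Fin M) :
    |violation S θ x k - violation S θ x' k| ≤ (M * ‖S.L θ‖ + N * ‖S.U θ‖) * b := by
  have key : ∀ (A : Fin N → Fin M → ℝ) i j, |A i j * x' i j - A i j * x i j| ≤ ‖A‖ * b + 0 := by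
    intro A i j
    rw [← mul_sub, abs_mul, abs_sub_comm, add_zero]
    exact mul_le_mul (abs_entry_le_norm A i j) (hb i j) (abs_nonneg _) (norm_nonneg _)
  have p1 : 0 ≤ M * (‖S.L θ‖ * b) := by positivity
  have p2 : 0 ≤ N * (‖S.U θ‖ * b) := by positivity
  rcases k with i | j
  · simp only [violation, Sum.elim_inl, sub_sub_sub_cancel_left]
    refine (abs_itemOutcome_sub_le _ _ _ _ (key (S.L θ)) i).trans ?_
    linarith
  · simp only [violation, Sum.elim_inr, sub_sub_sub_cancel_left]
    refine (abs_userOutcome_sub_le _ _ _ _ (key (S.U θ)) j).trans ?_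
    linarith

lemma rev_sub_rev (x z : Fin N → Fin M → ℝ) (θ : Instance N M) :
    rev x θ - rev z θ = rev (x - z) θ := by
  simp only [rev, ← Finset.sum_sub_distrib, Pi.sub_apply, mul_sub]

lemma instance_p_mem_Icc {θ : Instance N M} (h : θ ∈ instances N M) (j : Fin M) :
    θ.p j ∈ Set.Icc (0 : ℝ) 1 := by
  refine ⟨h.1.1 j, ?_⟩
  rw [← h.1.2]
  exact Finset.single_le_sum (f := θ.p) (fun i _ => h.1.1 i) (Finset.mem_univ j)

/-- The revenue of a fixed direction is Lipschitz in the instance. -/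
lemma abs_rev_sub_le {θ θ' : Instance N M} (hθ : θ ∈ instances N M) (hθ' : θ' ∈ instances N M)
    (hr : θ'.r = θ.r) (x : Fin N → Fin M → ℝ) :
    |rev x θ - rev x θ'| ≤ 2 * (N * M) * ‖θ.r‖ * ‖θ - θ'‖ * ‖x‖ := by
  unfold rev
  rw [hr]
  simp only [← Finset.sum_sub_distrib]
  have : ∀ i j, |θ.r i * θ.p j * θ.y i j * x i j - θ.r i * θ'.p j * θ'.y i j * x i j| ≤
      2 * ‖θ.r‖ * ‖θ - θ'‖ * ‖x‖ := by
    intro i j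
    have h1 : |θ.p j - θ'.p j| ≤ ‖θ - θ'‖ :=
      (norm_le_pi_norm (θ.p - θ'.p) j).trans (norm_fst_le (θ - θ'))
    have h2 : |θ.y i j - θ'.y i j| ≤ ‖θ - θ'‖ :=
      (abs_entry_sub_le θ.y θ'.y i j).trans ((norm_fst_le (θ - θ').2).trans (norm_snd_le (θ - θ')))
    have h3 : |θ.r i| ≤ ‖θ.r‖ := norm_le_pi_norm θ.r i
    have h4 := instance_p_mem_Icc hθ j
    have h5 := hθ'.2.1 i j
    have h6 : |θ.p j * θ.y i j - θ'.p j * θ'.y i j| ≤ 2 * ‖θ - θ'‖ := by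
      refine (abs_mul_sub_mul_le (by rw [abs_of_pos h5.1]; exact h5.2.le)).trans ?_
      rw [abs_of_nonneg h4.1]
      have := mul_le_of_le_one_left (abs_nonneg (θ.y i j - θ'.y i j)) h4.2
      linarith
    have h7 : θ.r i * θ.p j * θ.y i j * x i j - θ.r i * θ'.p j * θ'.y i j * x i j =
        θ.r i * (θ.p j * θ.y i j - θ'.p j * θ'.y i j) * x i j := by ring
    rw [h7, abs_mul, abs_mul]
    calc |θ.r i| * |θ.p j * θ.y i j - θ'.p j * θ'.y i j| * |x i j|
        ≤ ‖θ.r‖ * (2 * ‖θ - θ'‖) * ‖x‖ := by gcongr; exact abs_entry_le_norm x i j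
      _ = _ := by ring
  refine (Finset.abs_sum_le_sum_abs _ _).trans ?_
  refine (Finset.sum_le_sum fun i _ => (Finset.abs_sum_le_sum_abs _ _).trans
    (Finset.sum_le_sum fun j _ => this i j)).trans ?_
  simp only [Finset.sum_const, Finset.card_univ, Fintype.card_fin, nsmul_eq_mul]
  apply le_of_eq; ring

lemma abs_rev_le {θ : Instance N M} (hθ : θ ∈ instances N M) (x : Fin N → Fin M → ℝ) :
    |rev x θ| ≤ N * M * ‖θ.r‖ * ‖x‖ := by
  unfold rev
  have : ∀ i j, |θ.r i * θ.p j * θ.y i j * x i j| ≤ ‖θ.r‖ * ‖x‖ := by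
    intro i j
    have h3 : |θ.r i| ≤ ‖θ.r‖ := norm_le_pi_norm θ.r i
    have h4 := instance_p_mem_Icc hθ j
    have h5 := hθ.2.1 i j
    rw [abs_mul, abs_mul, abs_mul, abs_of_nonneg h4.1, abs_of_pos h5.1]
    calc |θ.r i| * θ.p j * θ.y i j * |x i j| ≤ ‖θ.r‖ * 1 * 1 * ‖x‖ := by
          have := h4.1; have := h4.2; have := h5.1.le; have := h5.2.le
          gcongr; exact abs_entry_le_norm x i j
      _ = _ := by ring
  refine (Finset.abs_sum_le_sum_abs _ _).trans ?_
  refine (Finset.sum_le_sum fun i _ => (Finset.abs_sum_le_sum_abs _ _).trans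
    (Finset.sum_le_sum fun j _ => this i j)).trans ?_
  simp only [Finset.sum_const, Finset.card_univ, Fintype.card_fin, nsmul_eq_mul]
  apply le_of_eq; ring

lemma rev_nonneg {θ : Instance N M} (hθ : θ ∈ instances N M) {x : Fin N → Fin M → ℝ}
    (hx : ∀ i j, 0 ≤ x i j) : 0 ≤ rev x θ :=
  Finset.sum_nonneg fun i _ => Finset.sum_nonneg fun j _ =>
    mul_nonneg (mul_nonneg (mul_nonneg (hθ.2.2 i).le (hθ.1.1 j)) (hθ.2.1 i j).1.le) (hx i j)

lemma rev_le {θ : Instance N M} (hθ : θ ∈ instances N M) {x : Fin N → Fin M → ℝ}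
    (hx : x ∈ recommendations N M) : rev x θ ≤ ‖θ.r‖ := by
  have h1 : rev x θ ≤ ∑ i, ∑ j, ‖θ.r‖ * (θ.p j * x i j) := by
    refine Finset.sum_le_sum fun i _ => Finset.sum_le_sum fun j _ => ?_
    have h3 : θ.r i ≤ ‖θ.r‖ := (le_abs_self _).trans (norm_le_pi_norm θ.r i)
    have h4 := (instance_p_mem_Icc hθ j).1
    have h5 := hθ.2.1 i j
    have h6 := (hx j).1 i
    have h7 := (hθ.2.2 i).le
    simp only at h6
    calc θ.r i * θ.p j * θ.y i j * x i j ≤ ‖θ.r‖ * θ.p j * 1 * x i j := by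
          have := h5.2.le; have := h5.1.le; gcongr
      _ = _ := by ring
  refine h1.trans (le_of_eq ?_)
  rw [Finset.sum_comm]
  have h2 : ∀ j, ∑ i, x i j = 1 := fun j => (hx j).2
  simp only [← Finset.mul_sum, h2, mul_one]
  rw [show ∑ j, θ.p j = 1 from hθ.1.2, mul_one]

/-- Expected revenue as a linear functional of the recommendations. -/
def revLin (θ : Instance N M) : (Fin N → Fin M → ℝ) →ₗ[ℝ] ℝ where
  toFun x := rev x θ
  map_add' x z := by simp [rev, mul_add, Finset.sum_add_distrib]
  map_smul' c x := by
    simp only [rev, Pi.smul_apply, smul_eq_mul, RingHom.id_apply, Finset.mul_sum]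
    exact Finset.sum_congr rfl fun i _ => Finset.sum_congr rfl fun j _ => by ring

/-- The outcome of an item as a linear functional of the recommendations. -/
def itemOutcomeLin (L : Fin N → Fin M → ℝ) (i : Fin N) : (Fin N → Fin M → ℝ) →ₗ[ℝ] ℝ where
  toFun x := itemOutcome L x i
  map_add' x z := by simp [itemOutcome, mul_add, Finset.sum_add_distrib]
  map_smul' c x := by
    simp only [itemOutcome, Pi.smul_apply, smul_eq_mul, RingHom.id_apply, Finset.mul_sum]
    exact Finset.sum_congr rfl fun j _ => by ring

/-- The outcome of a user type as a linear functional of the recommendations. -/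
def userOutcomeLin (U : Fin N → Fin M → ℝ) (j : Fin M) : (Fin N → Fin M → ℝ) →ₗ[ℝ] ℝ where
  toFun x := userOutcome U x j
  map_add' x z := by simp [userOutcome, mul_add, Finset.sum_add_distrib]
  map_smul' c x := by
    simp only [userOutcome, Pi.smul_apply, smul_eq_mul, RingHom.id_apply, Finset.mul_sum]
    exact Finset.sum_congr rfl fun i _ => by ring

lemma revLin_apply (θ : Instance N M) (x : Fin N → Fin M → ℝ) : revLin θ x = rev x θ := rfl

lemma itemOutcomeLin_apply (L : Fin N → Fin M → ℝ) (i : Fin N) (x : Fin N → Fin M → ℝ) :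
    itemOutcomeLin L i x = itemOutcome L x i := rfl

lemma userOutcomeLin_apply (U : Fin N → Fin M → ℝ) (j : Fin M) (x : Fin N → Fin M → ℝ) :
    userOutcomeLin U j x = userOutcome U x j := rfl

lemma isCompact_recommendations : IsCompact (recommendations N M) := by
  refine (isCompact_Icc (a := (0 : Fin N → Fin M → ℝ)) (b := 1)).of_isClosed_subset ?_ ?_
  · have : recommendations N M =
        ⋂ j, (fun x : Fin N → Fin M → ℝ => fun i => x i j) ⁻¹' stdSimplex ℝ (Fin N) := by
      ext x; simp [recommendations]
    rw [this]
    exact isClosed_iInter fun j => (isClosed_stdSimplex ℝ (Fin N)).preimage (by fun_prop)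
  · intro x hx
    exact ⟨fun i j => (recommendations_mem_Icc hx i j).1,
      fun i j => (recommendations_mem_Icc hx i j).2⟩

lemma exists_recommendations_polytope : ∃ (κ : Type) (_ : Finite κ)
    (g : κ → (Fin N → Fin M → ℝ) →ₗ[ℝ] ℝ) (b : κ → ℝ),
    ∀ x, x ∈ recommendations N M ↔ ∀ k, g k x ≤ b k := by
  refine ⟨(Fin N × Fin M) ⊕ Fin M ⊕ Fin M, inferInstance,
    Sum.elim (fun p => -(LinearMap.proj (R := ℝ) (φ := fun _ : Fin M => ℝ) p.2 ∘ₗ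
      LinearMap.proj (φ := fun _ : Fin N => Fin M → ℝ) p.1))
      (Sum.elim (fun j => userOutcomeLin (fun _ _ => 1) j)
        (fun j => -userOutcomeLin (fun _ _ => 1) j)),
    Sum.elim 0 (Sum.elim 1 (-1)), fun x => ?_⟩
  simp only [recommendations, Set.mem_ofPred_eq, stdSimplex, Sum.forall, Sum.elim_inl, Prod.forall,
    Sum.elim_inr, LinearMap.neg_apply, LinearMap.comp_apply, LinearMap.proj_apply, Pi.zero_apply,
    Left.neg_nonpos_iff, Pi.one_apply, Pi.neg_apply, neg_le_neg_iff, userOutcomeLin_apply,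
    userOutcome, one_mul]
  constructor
  · intro h
    exact ⟨fun i j => (h j).1 i, fun j => (h j).2.le, fun j => (h j).2.ge⟩
  · rintro ⟨h1, h2, h3⟩ j
    exact ⟨fun i => h1 i j, le_antisymm (h2 j) (h3 j)⟩

/-- Hoffman's bound for the set of optimal solutions of the fair recommendation problem. -/
lemma exists_optimal_error_bound (S : Spec N M) (θ : Instance N M)
    (hne : (S.feasible θ 0).Nonempty) :
    ∃ v K : ℝ, 0 ≤ K ∧ (∀ x ∈ S.feasible θ 0, rev x θ ≤ v) ∧
      ∀ x ∈ recommendations N M, ∀ s, 0 ≤ s → (∀ k, violation S θ x k ≤ s) → v - rev x θ ≤ s →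
        ∃ z ∈ S.feasible θ 0, v ≤ rev z θ ∧ ‖x - z‖ ≤ K * s := by
  obtain ⟨κ, _, g, b, hgb⟩ := exists_recommendations_polytope (N := N) (M := M)
  let a₀ : Fin N ⊕ Fin M → (Fin N → Fin M → ℝ) →ₗ[ℝ] ℝ :=
    Sum.elim (fun i => -itemOutcomeLin (S.L θ) i) (fun j => -userOutcomeLin (S.U θ) j)
  let β₀ : Fin N ⊕ Fin M → ℝ := Sum.elim
    (fun i => -(S.δI * itemOutcome (S.L θ) (S.fI θ) i))
    (fun j => -(S.δU * userOutcome (S.U θ) (S.fU θ) j))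
  have hviol : ∀ x k, violation S θ x k = a₀ k x - β₀ k := by
    intro x k
    rcases k with i | j
    · simp only [violation, a₀, β₀, Sum.elim_inl, LinearMap.neg_apply, itemOutcomeLin_apply]; ring
    · simp only [violation, a₀, β₀, Sum.elim_inr, LinearMap.neg_apply, userOutcomeLin_apply]; ring
  have hfeas : ∀ x, x ∈ S.feasible θ 0 ↔ x ∈ recommendations N M ∧ ∀ k, a₀ k x ≤ β₀ k := by
    intro x
    rw [mem_feasible_iff]
    simp only [hviol, sub_nonpos]
  have hcomp : IsCompact (S.feasible θ 0) := by
    have : S.feasible θ 0 = recommendations N M ∩ ⋂ k, {x | a₀ k x ≤ β₀ k} := by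
      ext x; rw [hfeas]; simp
    rw [this]
    exact isCompact_recommendations.inter_right (isClosed_iInter fun k =>
      isClosed_le (a₀ k).continuous_of_finiteDimensional continuous_const)
  obtain ⟨z₀, hz₀, hmax⟩ := hcomp.exists_isMaxOn hne
    (revLin θ).continuous_of_finiteDimensional.continuousOn
  have hmax' : ∀ x ∈ S.feasible θ 0, rev x θ ≤ rev z₀ θ := fun x hx => hmax hx
  -- Optimality becomes one more linear constraint, indexed by `none`: the revenue must reach the
  -- maximum. Hoffman's bound for the enlarged system measures the distance to the set of optimal
  -- solutions.
  let a : Option (Fin N ⊕ Fin M) → (Fin N → Fin M → ℝ) →L[ℝ] ℝ := fun k =>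
    LinearMap.toContinuousLinearMap (k.elim (-revLin θ) a₀)
  let β : Option (Fin N ⊕ Fin M) → ℝ := fun k => k.elim (-rev z₀ θ) β₀
  have hset : {x | ∀ k, g k x ≤ b k} = recommendations N M := by
    ext x; rw [hgb]; rfl
  obtain ⟨K, hK, hH⟩ := exists_hoffman_bound g b (by rw [hset]; exact isCompact_recommendations)
    a β ⟨z₀, (hgb z₀).1 hz₀.1, by
      rintro (_ | k)
      · simp [a, β, revLin_apply]
      · simpa [a, β] using ((hfeas z₀).1 hz₀).2 k⟩
  refine ⟨rev z₀ θ, K, hK, hmax', fun x hx s hs hv hr => ?_⟩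
  obtain ⟨z, h1, h2, h3⟩ := hH x s ((hgb x).1 hx) hs (by
    rintro (_ | k)
    · simp only [a, β, Option.elim_none, LinearMap.coe_toContinuousLinearMap', LinearMap.neg_apply,
        revLin_apply]
      linarith
    · have := hv k
      rw [hviol] at this
      simp only [a, β, Option.elim_some, LinearMap.coe_toContinuousLinearMap']
      linarith)
  refine ⟨z, (hfeas z).2 ⟨(hgb z).2 h1, fun k => ?_⟩, ?_, h3⟩
  · simpa [a, β] using h2 (some k)
  · simpa [a, β, revLin_apply] using h2 none

/-- Disposes of the case in which the problem at `θ₀` is infeasible: then nearby instances have no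
feasible problem either, and the claim about them is vacuous. -/
lemma exists_not_feasible (S : Spec N M) (θ : Instance N M) (hne : ¬ (S.feasible θ 0).Nonempty) :
    ∃ s : ℝ, 0 < s ∧ ¬ (S.feasible θ s).Nonempty := by
  have hcont : ∀ k, Continuous fun x => violation S θ x k := by
    rintro (i | j)
    · exact continuous_const.sub (itemOutcomeLin (S.L θ) i).continuous_of_finiteDimensional
    · exact continuous_const.sub (userOutcomeLin (S.U θ) j).continuous_of_finiteDimensional
  have := exists_relaxation_infeasible isCompact_recommendations
    (fun k x => violation S θ x k) hcont 0 (by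
      rintro ⟨x, h1, h2⟩
      exact hne ⟨x, (mem_feasible_iff S θ 0 x).2 ⟨h1, h2⟩⟩)
  obtain ⟨s, hs, h⟩ := this
  refine ⟨s, hs, ?_⟩
  rintro ⟨x, hx⟩
  have := (mem_feasible_iff S θ s x).1 hx
  exact h ⟨x, this.1, fun k => by simpa using this.2 k⟩

set_option maxHeartbeats 1000000 in
/-- Optimal solutions of the relaxed problem at an estimated instance compete with the optimal
solution of the original problem, up to an error of second order. -/
lemma exists_perturbation_bound {S : Spec N M} (hS : S.Valid) {θ₀ : Instance N M}
    (hθ₀ : θ₀ ∈ instances N M) (hL : S.LocallyLipschitzAt θ₀) :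
    ∃ K ζ : ℝ, 0 ≤ K ∧ 0 < ζ ∧ ∀ θT ∈ instances N M, θT.r = θ₀.r → ∀ τ, ‖θT - θ₀‖ ≤ τ → τ ≤ ζ →
      ∀ xs, S.IsOptimal θT 0 xs →
      ∀ θ ∈ instances N M, θ.r = θ₀.r → ∀ ρ, ‖θ - θ₀‖ ≤ ρ → ρ ≤ ζ →
      ∀ η, K * (ρ + τ) ≤ η →
        (S.feasible θ η).Nonempty ∧ ∀ x, S.IsOptimal θ η x →
          rev xs θT - rev x θT ≤ K * τ + K * (ρ * η) ∧
          ∀ k, violation S θT x k ≤ η + K * (ρ + τ) := by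
  obtain ⟨K₂, ζ, hK₂, hζ, hLip⟩ := exists_violation_lipschitz hS hθ₀ hL
  have htrans : ∀ θ ∈ instances N M, ∀ ρ, ‖θ - θ₀‖ ≤ ρ → ρ ≤ ζ → ∀ x ∈ recommendations N M, ∀ k,
      violation S θ x k ≤ violation S θ₀ x k + K₂ * ρ ∧
      violation S θ₀ x k ≤ violation S θ x k + K₂ * ρ := by
    intro θ hθ ρ h1 h2 x hx k
    have h3 := abs_le.1 (hLip θ hθ (h1.trans h2) x hx k)
    have h4 := mul_le_mul_of_nonneg_left h1 hK₂
    constructor <;> linarith [h3.1, h3.2]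
  by_cases hne : (S.feasible θ₀ 0).Nonempty
  swap
  -- A feasible `xs` at `θT` would violate the constraints at `θ₀` by at most `K₂ τ ≤ s`, contrary
  -- to the choice of `s`.
  · obtain ⟨s, hs, hs'⟩ := exists_not_feasible S θ₀ hne
    refine ⟨0, min ζ (s / (K₂ + 1)), le_rfl, lt_min hζ (by positivity), ?_⟩
    intro θT hθT _ τ h1 h2 xs hxs
    exfalso
    apply hs'
    have h3 := (mem_feasible_iff _ _ _ _).1 hxs.1
    refine ⟨xs, (mem_feasible_iff _ _ _ _).2 ⟨h3.1, fun k => ?_⟩⟩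
    have h4 := (htrans θT hθT τ h1 (h2.trans (min_le_left _ _)) xs h3.1 k).2
    have h5 := h3.2 k
    have h6 := h2.trans (min_le_right _ _)
    rw [le_div_iff₀ (by positivity)] at h6
    have h7 : 0 ≤ τ := (norm_nonneg _).trans h1
    nlinarith
  obtain ⟨v, K₃, hK₃, hv, hH⟩ := exists_optimal_error_bound S θ₀ hne
  set Kr : ℝ := 2 * (N * M) * ‖θ₀.r‖ with hKr
  have hKr0 : 0 ≤ Kr := by positivity
  -- First-order cost in `τ`: `2 Kr` for moving two revenues between `θT` and `θ₀`, and `Kr K₃ K₂`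
  -- for the amount by which `xs`, only nearly feasible at `θ₀`, may beat the optimal value there.
  set A := Kr * K₃ * K₂ + 2 * Kr with hA
  have hA0 : 0 ≤ A := by positivity
  refine ⟨K₂ + A + 4 * (Kr * K₃), min ζ (1 / (2 * (Kr * K₃ + 1))), by positivity,
    lt_min hζ (by positivity), ?_⟩
  intro θT hθT hrT τ hτ hτζ xs hxs θ hθ hr ρ hρ hρζ η hη
  have hτ0 : 0 ≤ τ := (norm_nonneg _).trans hτ
  have hρ0 : 0 ≤ ρ := (norm_nonneg _).trans hρ
  have hτ1 := hτζ.trans (min_le_left _ _)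
  have hρ1 := hρζ.trans (min_le_left _ _)
  have q1 : 0 ≤ K₂ * ρ := by positivity
  have q2 : 0 ≤ K₂ * τ := by positivity
  have q3 : 0 ≤ A * (ρ + τ) := by positivity
  have q4 : 0 ≤ 4 * (Kr * K₃) * (ρ + τ) := by positivity
  have hη1 : K₂ * (ρ + τ) ≤ η := by linarith
  have hη0 : 0 ≤ η := by linarith
  have hxs1 := (mem_feasible_iff _ _ _ _).1 hxs.1
  have hxs0 : ∀ k, violation S θ₀ xs k ≤ K₂ * τ := fun k => by
    linarith [(htrans θT hθT τ hτ hτ1 xs hxs1.1 k).2, hxs1.2 k]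
  refine ⟨⟨xs, (mem_feasible_iff _ _ _ _).2 ⟨hxs1.1, fun k => ?_⟩⟩, fun x hx => ?_⟩
  · linarith [(htrans θ hθ ρ hρ hρ1 xs hxs1.1 k).1, hxs0 k]
  have hx1 := (mem_feasible_iff _ _ _ _).1 hx.1
  have hx0 : ∀ k, violation S θ₀ x k ≤ η + K₂ * ρ := fun k => by
    linarith [(htrans θ hθ ρ hρ hρ1 x hx1.1 k).2, hx1.2 k]
  have hnorm1 : ∀ x ∈ recommendations N M, ‖x‖ ≤ 1 := fun x hx => by
    refine (pi_norm_le_iff_of_nonneg zero_le_one).2 fun i =>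
      (pi_norm_le_iff_of_nonneg zero_le_one).2 fun j => recommendations_abs_le hx i j
  have hrevT : ∀ x ∈ recommendations N M, |rev x θ₀ - rev x θT| ≤ Kr * τ := fun x hx => by
    refine (abs_rev_sub_le hθ₀ hθT hrT x).trans ?_
    rw [← hKr, norm_sub_rev]
    calc Kr * ‖θT - θ₀‖ * ‖x‖ ≤ Kr * τ * 1 := by gcongr; exact hnorm1 x hx
      _ = _ := mul_one _
  have hxsv : rev xs θ₀ ≤ v + Kr * K₃ * K₂ * τ := by
    rcases le_total (rev xs θ₀) v with h | h
    · have : 0 ≤ Kr * K₃ * K₂ * τ := by positivity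
      linarith
    · obtain ⟨z, hz1, hz2, hz3⟩ := hH xs hxs1.1 (K₂ * τ) q2 hxs0 (by linarith)
      have h1 := (le_abs_self _).trans (abs_rev_le hθ₀ (xs - z))
      rw [← rev_sub_rev] at h1
      have h2 : N * M * ‖θ₀.r‖ * ‖xs - z‖ ≤ Kr * (K₃ * (K₂ * τ)) := by
        calc N * M * ‖θ₀.r‖ * ‖xs - z‖ ≤ (2 * (N * M) * ‖θ₀.r‖) * ‖xs - z‖ := by
              have : 0 ≤ N * M * ‖θ₀.r‖ * ‖xs - z‖ := by positivity
              linarith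
          _ ≤ _ := by rw [← hKr]; gcongr
      linarith [hv z hz1]
  -- The second-order estimate. Put `g = v - rev x θ₀`. Hoffman gives an optimal `z` with `‖x - z‖ ≤
  -- K₃ (2 η + g)`. As `z` is feasible for the relaxed problem at `θ`, `x` is no worse than `z`
  -- there, so `g ≤ Kr ρ ‖x - z‖`. The choice of `ζ` makes `Kr K₃ ρ ≤ 1 / 2`, so the term in `g` is
  -- absorbed on the left.
  have hxv : v - rev x θ₀ ≤ 4 * (Kr * K₃) * (ρ * η) := by
    rcases le_total (v - rev x θ₀) 0 with h | h
    · exact h.trans (by positivity)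
    · obtain ⟨z, hz1, hz2, hz3⟩ := hH x hx1.1 (2 * η + (v - rev x θ₀)) (by linarith)
        (fun k => by linarith [hx0 k]) (by linarith)
      have hz0 := (mem_feasible_iff _ _ _ _).1 hz1
      have h1 := hx.2 z ((mem_feasible_iff _ _ _ _).2 ⟨hz0.1, fun k => by
        linarith [(htrans θ hθ ρ hρ hρ1 z hz0.1 k).1, hz0.2 k]⟩)
      have h2 := (neg_abs_le _).trans' (neg_le_neg (abs_rev_sub_le hθ₀ hθ hr (x - z)))
      rw [← rev_sub_rev, ← rev_sub_rev, ← hKr, norm_sub_rev] at h2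
      have h3 : Kr * ‖θ - θ₀‖ * ‖x - z‖ ≤ Kr * ρ * (K₃ * (2 * η + (v - rev x θ₀))) := by gcongr
      have h4 : Kr * K₃ * ρ ≤ 1 / 2 := by
        have h5 := hρζ.trans (min_le_right _ _)
        rw [le_div_iff₀ (by positivity)] at h5
        have : 0 ≤ Kr * K₃ := by positivity
        nlinarith
      have h6 := mul_le_mul_of_nonneg_right h4 h
      linarith [mul_le_mul_of_nonneg_right h4 hη0]
  have e1 := abs_le.1 (hrevT xs hxs1.1)
  have e2 := abs_le.1 (hrevT x hx1.1)
  have q5 : 0 ≤ (K₂ + 4 * (Kr * K₃)) * τ := by positivity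
  have q6 : 0 ≤ (K₂ + A) * (ρ * η) := by positivity
  refine ⟨by linarith [e1.1, e1.2, e2.1, e2.2], fun k => ?_⟩
  have h1 := (htrans θT hθT τ hτ hτ1 x hx1.1 k).1
  linarith [hx0 k]

end Deterministic

/-! ### Estimation errors on concentrated histories -/

section Estimation

variable {N M : ℕ} {parr : ℕ → Fin M → ℝ} {y : Fin N → Fin M → ℝ}
  {xhat : History N M → Fin N → Fin M → ℝ}

lemma meanArrival_eq (n : ℕ) (j : Fin M) :
    meanArrival parr n j = 1 / (n : ℝ) * ∑ k ∈ Finset.range n, parr (k + 1) j := by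
  unfold meanArrival
  congr 1
  rw [Finset.range_eq_Ico, Finset.sum_Ico_add' (fun t => parr t j) 0 n 1]
  rfl

lemma meanArrival_mem (hp : ∀ t, parr t ∈ stdSimplex ℝ (Fin M)) {n : ℕ} (hn : 0 < n) :
    meanArrival parr n ∈ stdSimplex ℝ (Fin M) := by
  refine ⟨fun j => ?_, ?_⟩
  · rw [meanArrival_eq]
    exact mul_nonneg (by positivity) (Finset.sum_nonneg fun k _ => (hp _).1 j)
  · simp only [meanArrival_eq, ← Finset.mul_sum]
    rw [Finset.sum_comm]
    have : ∀ k, ∑ j, parr (k + 1) j = 1 := fun k => (hp _).2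
    have hn' : (n : ℝ) ≠ 0 := by positivity
    simp [this, hn']

/-- Partial sums of the periodic arrival probabilities grow linearly up to one period. -/
lemma abs_sum_arrival_sub_le (hp : ∀ t, parr t ∈ stdSimplex ℝ (Fin M)) {Q : ℕ} (hQ : 0 < Q)
    (hper : ∀ t, parr (t + Q) = parr t) (j : Fin M) (n : ℕ) :
    |∑ k ∈ Finset.range n, parr (k + 1) j - n * meanArrival parr Q j| ≤ Q := by
  have hm := arrival_mem_Icc (parr := fun _ => meanArrival parr Q)
    (fun _ => meanArrival_mem hp hQ) 0 j
  induction n using Nat.strong_induction_on with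
  | _ n ih =>
    -- A full period contributes exactly `Q` times the mean, so it can be removed; for the remainder
    -- both quantities lie in `[0, n]` with `n < Q`.
    rcases lt_or_ge n Q with h | h
    · have h1 : ∑ k ∈ Finset.range n, parr (k + 1) j ≤ n := by
        refine (Finset.sum_le_sum fun k _ => (arrival_mem_Icc hp (k + 1) j).2).trans ?_
        simp
      have h0 : 0 ≤ ∑ k ∈ Finset.range n, parr (k + 1) j :=
        Finset.sum_nonneg fun k _ => (hp _).1 j
      have h2 : (n : ℝ) ≤ Q := by exact_mod_cast h.le
      have h3 : (n : ℝ) * meanArrival parr Q j ≤ n := mul_le_of_le_one_right (by positivity) hm.2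
      have h4 : 0 ≤ (n : ℝ) * meanArrival parr Q j := mul_nonneg (by positivity) hm.1
      rw [abs_le]; constructor <;> linarith
    · obtain ⟨m, rfl⟩ := Nat.exists_eq_add_of_le h
      have h1 := ih m (by omega)
      rw [Finset.sum_range_add]
      have h2 : ∑ k ∈ Finset.range Q, parr (k + 1) j = Q * meanArrival parr Q j := by
        rw [meanArrival_eq]; field_simp
      have h3 : ∀ k, parr (Q + k + 1) j = parr (k + 1) j := fun k => by
        rw [show Q + k + 1 = (k + 1) + Q by ring, hper]
      simp only [h2, h3]
      push_cast
      convert h1 using 2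
      ring

lemma sum_arrivals (h : History N M) : ∑ j, (arrivals h j : ℝ) = h.length := by
  induction h with
  | nil => simp [arrivals]
  | cons o h ih =>
    simp only [arrivals_cons, Finset.sum_add_distrib, ih]
    simp

lemma pHat_mem_stdSimplex {w : ℕ} (hw : 1 ≤ w) {h : History N M} (hh : 1 ≤ h.length) :
    pHat w h ∈ stdSimplex ℝ (Fin M) := by
  have hne : h ≠ [] := by rintro rfl; simp at hh
  have hm : 1 ≤ min h.length w := le_min hh hw
  have hm' : ((min h.length w : ℕ) : ℝ) ≠ 0 := by positivity
  refine ⟨fun j => ?_, ?_⟩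
  · simp only [pHat, if_neg hne]; positivity
  · simp only [pHat, if_neg hne, ← Finset.sum_div, sum_arrivals, List.length_take]
    rw [min_comm w, div_self hm']

lemma arrivals_append (h h' : History N M) (j : Fin M) :
    arrivals (h ++ h') j = arrivals h j + arrivals h' j := List.countP_append

/-- Estimation errors after a concentrated history. -/
lemma abs_estimate_sub_le (hp : ∀ t, parr t ∈ stdSimplex ℝ (Fin M)) {Q : ℕ} (hQ : 0 < Q)
    (hper : ∀ t, parr (t + Q) = parr t) {w : ℕ} {a pm : ℝ} (ha : 1 ≤ a) (hpm : 0 < pm)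
    (hpm' : ∀ j, pm ≤ meanArrival parr Q j) {h : History N M} (hN : 0 < N) (hh : N ≤ h.length)
    (hw : (h.length : ℝ) ^ (2 / 3 : ℝ) ≤ w)
    (hlarge : Q + a * Real.sqrt h.length ≤ h.length * (pm / 2))
    (hc : Concentrated parr y xhat w a h) :
    (∀ i j, |yHat xhat h i j - y i j| ≤
      (2 * N / pm + 1 + 2 * Q) * a * (h.length : ℝ) ^ (-(1 / 3) : ℝ)) ∧
    ∀ j, |pHat w h j - meanArrival parr Q j| ≤
      (2 * N / pm + 1 + 2 * Q) * a * (h.length : ℝ) ^ (-(1 / 3) : ℝ) := by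
  obtain ⟨c1, c2, c3⟩ := hc
  set k := h.length with hk
  have hk1 : 1 ≤ k := by omega
  have hk0 : (0 : ℝ) < k := by exact_mod_cast hk1
  have hk1' : (1 : ℝ) ≤ k := by exact_mod_cast hk1
  have hN0 : (0 : ℝ) < N := by exact_mod_cast hN
  have hN1 : (1 : ℝ) ≤ N := by exact_mod_cast hN
  set s : ℝ := (k : ℝ) ^ (1 / 3 : ℝ) with hs
  have hs0 : 0 < s := by positivity
  have hs3 : s ^ 3 = k := by
    rw [hs, ← Real.rpow_natCast, ← Real.rpow_mul hk0.le]; norm_num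
  have hs2 : (k : ℝ) ^ (2 / 3 : ℝ) = s ^ 2 := by
    rw [hs, ← Real.rpow_natCast, ← Real.rpow_mul hk0.le]; norm_num
  have hsinv : (k : ℝ) ^ (-(1 / 3) : ℝ) = s⁻¹ := by rw [hs, Real.rpow_neg hk0.le]
  have hs1 : 1 ≤ s := Real.one_le_rpow hk1' (by norm_num)
  rw [hsinv]
  constructor
  · intro i j
    have hd : |arrivalDev parr j h| ≤ a * Real.sqrt k := by
      have := c2 j
      rw [abs_mul, abs_of_nonneg (by positivity), one_div, inv_mul_le_iff₀ (by positivity)] at this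
      linarith
    have hn : k * (pm / 2) ≤ (arrivals h j : ℝ) := by
      have h1 := abs_le.1 (abs_sum_arrival_sub_le hp hQ hper j k)
      have h2 := abs_le.1 hd
      unfold arrivalDev at h2
      rw [← hk] at h2
      have h3 := mul_le_mul_of_nonneg_left (hpm' j) hk0.le
      linarith [h1.1, h2.1]
    have hn0 : (0 : ℝ) < arrivals h j := lt_of_lt_of_le (by positivity) hn
    have hn0' : arrivals h j ≠ 0 := by
      intro h0; rw [h0] at hn0; simp at hn0
    -- That is, `k ε_k ≥ (s / N) ^ 2`. The power of `N` is wasteful, but estimation errors enter the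
    -- final rates only through terms that vanish against the main ones.
    have he : s / N ≤ k * Real.sqrt (explore N k / k) := by
      have h1 : (s / N) ^ 2 ≤ k * explore N k := by
        unfold explore
        rw [mul_min_of_nonneg _ _ hk0.le]
        refine le_min ?_ ?_
        · rw [div_pow, ← div_eq_mul_inv, div_le_div_iff₀ (by positivity) (by positivity), ← hs3]
          nlinarith [mul_le_mul hN1 hs1 (by norm_num) (by positivity), mul_pos hN0 (pow_pos hs0 2),
            mul_nonneg (mul_pos hN0 (pow_pos hs0 2)).le (sub_nonneg.2 (show (1:ℝ) ≤ s * N by nlinarith))]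
        · rw [hsinv, ← hs3]
          have h2 : (N : ℝ) ^ (-2 : ℝ) ≤ (N : ℝ) ^ (-(2 / 3) : ℝ) :=
            Real.rpow_le_rpow_of_exponent_le hN1 (by norm_num)
          have h3 : (N : ℝ) ^ (-2 : ℝ) = ((N : ℝ) ^ 2)⁻¹ := by
            rw [Real.rpow_neg hN0.le]; norm_num
          rw [h3] at h2
          calc (s / N) ^ 2 = s ^ 2 * ((N : ℝ) ^ 2)⁻¹ := by rw [div_pow, div_eq_mul_inv]
            _ ≤ s ^ 2 * (N : ℝ) ^ (-(2 / 3) : ℝ) := by gcongr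
            _ = _ := by field_simp
      have h2 : (k : ℝ) * Real.sqrt (explore N k / k) = Real.sqrt (k * explore N k) := by
        have : (k : ℝ) * explore N k = k ^ 2 * (explore N k / k) := by field_simp
        rw [this, Real.sqrt_mul (by positivity), Real.sqrt_sq hk0.le]
      rw [h2]
      exact Real.le_sqrt_of_sq_le h1
    have hD : |ipwDev y xhat i j h| * (s / N) ≤ a * k := by
      have h1 := c1 i j
      rw [abs_mul, abs_of_nonneg (Real.sqrt_nonneg _)] at h1
      have h2 := mul_le_mul_of_nonneg_left he (abs_nonneg (ipwDev y xhat i j h))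
      nlinarith [mul_le_mul_of_nonneg_right h1 hk0.le]
    have hyd : yHat xhat h i j - y i j = ipwDev y xhat i j h / arrivals h j := by
      unfold yHat ipwDev
      rw [if_neg hn0']
      field_simp
    rw [hyd, abs_div, abs_of_pos hn0, div_le_iff₀ hn0]
    have h5 : |ipwDev y xhat i j h| ≤ N * a * k * s⁻¹ := by
      rw [← div_eq_mul_inv, le_div_iff₀ hs0]
      rw [mul_div_assoc', div_le_iff₀ hN0] at hD
      linarith
    have h6 : N * a * k * s⁻¹ = (2 * N / pm) * a * s⁻¹ * (k * (pm / 2)) := by field_simp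
    calc |ipwDev y xhat i j h| ≤ (2 * N / pm) * a * s⁻¹ * (k * (pm / 2)) := h5.trans h6.le
      _ ≤ (2 * N / pm + 1 + 2 * Q) * a * s⁻¹ * arrivals h j := by
        gcongr
        have : (0 : ℝ) ≤ Q := by positivity
        linarith
  · intro j
    have hne : h ≠ [] := by rintro rfl; simp at hk; omega
    have hw1 : (1 : ℝ) ≤ w := le_trans (by rw [hs2]; nlinarith) hw
    have hw1' : 1 ≤ w := by exact_mod_cast hw1
    set m := min k w with hm
    have hm1 : 1 ≤ m := le_min hk1 hw1'
    have hm0 : (0 : ℝ) < m := by exact_mod_cast hm1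
    have hms : s ≤ Real.sqrt m := by
      refine Real.le_sqrt_of_sq_le ?_
      rw [hm, Nat.cast_min]
      refine le_min ?_ (hs2 ▸ hw)
      rw [← hs3]; nlinarith [pow_pos hs0 2]
    have h1 : |arrivalDev parr j h - arrivalDev parr j (h.drop w)| ≤ a * Real.sqrt m := by
      have := c3 j
      rw [abs_mul, abs_of_nonneg (by positivity), one_div, inv_mul_le_iff₀ (by positivity)] at this
      linarith
    have h2 : (arrivals h j : ℝ) = arrivals (h.take w) j + arrivals (h.drop w) j := by
      rw [← Nat.cast_add, ← arrivals_append, List.take_append_drop]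
    have h3 : (h.drop w).length = k - m := by rw [List.length_drop]; omega
    have h4 := abs_le.1 (abs_sum_arrival_sub_le hp hQ hper j k)
    have h5 := abs_le.1 (abs_sum_arrival_sub_le hp hQ hper j (k - m))
    unfold arrivalDev at h1
    rw [h2, h3, ← hk] at h1
    have h1 := abs_le.1 h1
    rw [Nat.cast_sub (min_le_left _ _)] at h5
    -- The window is the difference of two initial segments, and each sum of arrival probabilities
    -- is within `Q` of its linear value; hence `2 Q`.
    have h6 : |(arrivals (h.take w) j : ℝ) - m * meanArrival parr Q j| ≤
        a * Real.sqrt m + 2 * Q := by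
      rw [abs_le]; constructor <;> linarith [h1.1, h1.2, h4.1, h4.2, h5.1, h5.2]
    have h7 : pHat w h j - meanArrival parr Q j =
        ((arrivals (h.take w) j : ℝ) - m * meanArrival parr Q j) / m := by
      simp only [pHat, if_neg hne, ← hk, ← hm]
      field_simp
    rw [h7, abs_div, abs_of_pos hm0, div_le_iff₀ hm0]
    refine h6.trans ?_
    have hsm : Real.sqrt m * Real.sqrt m = m := Real.mul_self_sqrt hm0.le
    have hsm1 : 1 ≤ Real.sqrt m := hs1.trans hms
    have h8 : Real.sqrt m ≤ s⁻¹ * m := by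
      rw [inv_mul_eq_div, le_div_iff₀ hs0]
      nlinarith
    have hQ0 : (0 : ℝ) ≤ Q := by positivity
    have hNp : 0 ≤ 2 * N / pm := by positivity
    calc a * Real.sqrt m + 2 * Q ≤ (1 + 2 * Q) * a * Real.sqrt m := by
          have h9 : 1 ≤ a * Real.sqrt m := one_le_mul_of_one_le_of_one_le ha hsm1
          linarith [mul_le_mul_of_nonneg_left h9 hQ0]
      _ ≤ (2 * N / pm + 1 + 2 * Q) * a * (s⁻¹ * m) := by gcongr; linarith
      _ = _ := by ring

end Estimation

/-! ### Orders of magnitude of exploration and relaxation -/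

section Rates

/-- Partial sums of `(k + 1) ^ (-1 / 3)`. -/
lemma sum_rpow_neg_third_le (T : ℕ) :
    ∑ k ∈ Finset.range T, ((k + 1 : ℕ) : ℝ) ^ (-(1 / 3) : ℝ) ≤ 2 * (T : ℝ) ^ (2 / 3 : ℝ) := by
  induction T with
  | zero => simp
  | succ T ih =>
    rw [Finset.sum_range_succ]
    have h0 : (0 : ℝ) ≤ T := by positivity
    have h1 : (0 : ℝ) < (T + 1 : ℕ) := by positivity
    set s : ℝ := ((T + 1 : ℕ) : ℝ) ^ (1 / 3 : ℝ) with hs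
    set q : ℝ := (T : ℝ) ^ (1 / 3 : ℝ) with hq
    have hs0 : 0 < s := by positivity
    have hq0 : 0 ≤ q := by positivity
    have hqs : q ≤ s := Real.rpow_le_rpow h0 (by push_cast; linarith) (by norm_num)
    have hs3 : s ^ 3 = T + 1 := by
      rw [hs, ← Real.rpow_natCast, ← Real.rpow_mul h1.le]; norm_num
    have hq3 : q ^ 3 = T := by
      rw [hq, ← Real.rpow_natCast, ← Real.rpow_mul h0]; norm_num
    have hs2 : ((T + 1 : ℕ) : ℝ) ^ (2 / 3 : ℝ) = s ^ 2 := by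
      rw [hs, ← Real.rpow_natCast, ← Real.rpow_mul h1.le]; norm_num
    have hq2 : (T : ℝ) ^ (2 / 3 : ℝ) = q ^ 2 := by
      rw [hq, ← Real.rpow_natCast, ← Real.rpow_mul h0]; norm_num
    have hsi : ((T + 1 : ℕ) : ℝ) ^ (-(1 / 3) : ℝ) = s⁻¹ := by rw [hs, Real.rpow_neg h1.le]
    rw [hsi, hs2]
    rw [hq2] at ih
    -- With `s ^ 3 - q ^ 3 = 1` the claim is equivalent to `s ^ 3 - 2 q ^ 2 s + q ^ 3 ≥ 0`, which
    -- factors as in `h4`.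
    have : s⁻¹ ≤ 2 * (s ^ 2 - q ^ 2) := by
      rw [inv_le_iff_one_le_mul₀ hs0]
      have h3 : s ^ 3 - q ^ 3 = 1 := by rw [hs3, hq3]; ring
      have h4 : 0 ≤ (s - q) * (s ^ 2 + s * q - q ^ 2) := by
        apply mul_nonneg (by linarith); nlinarith
      nlinarith
    linarith

lemma rpow_third_pow {x : ℝ} (hx : 0 ≤ x) : (x ^ (1 / 3 : ℝ)) ^ 3 = x := by
  rw [← Real.rpow_natCast, ← Real.rpow_mul hx]; norm_num

lemma rpow_neg_third {x : ℝ} (hx : 0 ≤ x) : x ^ (-(1 / 3) : ℝ) = (x ^ (1 / 3 : ℝ))⁻¹ :=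
  Real.rpow_neg hx _

/-- The total probability of exploring in a round. This is the term that determines the revenue
rate. -/
lemma explore_mul_le (N : ℕ) (hN : 0 < N) (t : ℕ) :
    N * explore N t ≤ (N : ℝ) ^ (1 / 3 : ℝ) * (t : ℝ) ^ (-(1 / 3) : ℝ) := by
  have hN0 : (0 : ℝ) < N := by exact_mod_cast hN
  calc N * explore N t ≤ N * ((N : ℝ) ^ (-(2 / 3) : ℝ) * (t : ℝ) ^ (-(1 / 3) : ℝ)) := by
        gcongr; exact min_le_right _ _
    _ = (N : ℝ) ^ (1 / 3 : ℝ) * (t : ℝ) ^ (-(1 / 3) : ℝ) := by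
      rw [← mul_assoc]
      congr 1
      nth_rewrite 1 [← Real.rpow_one (N : ℝ)]
      rw [← Real.rpow_add hN0]; norm_num

/-- In `gammaY` the root is at most `t ^ (1/3)`, because `ε_t ≤ t ^ (-1/3)` and the maximum is at
most `t`. The spare factor `log T` over the estimation error lets the relaxation absorb all unknown
constants. -/
lemma relax_lower {N M Q T t : ℕ} (hN : 0 < N) (hM : 0 < M) (ht : 1 ≤ t)
    (hl : 1 ≤ Real.log T) :
    Real.log T ^ 2 * (t : ℝ) ^ (-(1 / 3) : ℝ) ≤ relax N M Q T t := by
  set l := Real.log T with hl'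
  have ht0 : (0 : ℝ) < t := by exact_mod_cast ht
  have ht1 : (1 : ℝ) ≤ t := by exact_mod_cast ht
  have hN0 : (0 : ℝ) < N := by exact_mod_cast hN
  have hN1 : (1 : ℝ) ≤ N := by exact_mod_cast hN
  have hM1 : (1 : ℝ) ≤ M := by exact_mod_cast hM
  rw [rpow_neg_third ht0.le]
  set s : ℝ := (t : ℝ) ^ (1 / 3 : ℝ) with hs
  have hs0 : 0 < s := by positivity
  have hs3 : s ^ 3 = t := rpow_third_pow ht0.le
  have he0 : 0 < explore N t := lt_min (by positivity) (by positivity)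
  have he : explore N t ≤ s⁻¹ := by
    refine (min_le_right _ _).trans ?_
    rw [rpow_neg_third ht0.le, ← hs]
    exact mul_le_of_le_one_left (by positivity)
      (Real.rpow_le_one_of_one_le_of_nonpos hN1 (by norm_num))
  have hmax : max 1 (t / l - Real.sqrt (t * l / 2)) ≤ t := by
    refine max_le ht1 ?_
    have : t / l ≤ t := div_le_self ht0.le hl
    linarith [Real.sqrt_nonneg (t * l / 2)]
  have hsqrt : Real.sqrt (explore N t * max 1 (t / l - Real.sqrt (t * l / 2))) ≤ s := by
    rw [Real.sqrt_le_left hs0.le]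
    calc _ ≤ s⁻¹ * t := by gcongr
      _ = s ^ 2 := by rw [← hs3]; field_simp
  have hpos : 0 < Real.sqrt (explore N t * max 1 (t / l - Real.sqrt (t * l / 2))) :=
    Real.sqrt_pos.2 (mul_pos he0 (lt_of_lt_of_le one_pos (le_max_left _ _)))
  have hg : l * s⁻¹ ≤ gammaY N T t := by
    unfold gammaY
    rw [← hl', le_div_iff₀ hpos]
    calc l * s⁻¹ * _ ≤ l * s⁻¹ * s := by gcongr
      _ = l := by field_simp
      _ ≤ 2 * l := by linarith
  unfold relax
  rw [← hl']
  calc l ^ 2 * s⁻¹ = 1 * l * (l * s⁻¹) := by ring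
    _ ≤ M * l * max (gammaY N T t) (gammaP Q T) := by
      gcongr
      exact hg.trans (le_max_left _ _)

/-- The root in `gammaY` is at least `t ^ (1/3) / (2 N ^ (1/3) √(log T))`, so `gammaY` has order
`(log T) ^ (3/2)`; the factor `log T` in `relax` makes it `5 / 2`. The window term is smaller since
the window contains at least `t ^ (2/3)` rounds. -/
lemma relax_upper {N M Q T t : ℕ} (hN : 0 < N) (hQ : 0 < Q) (ht : N ≤ t) (htT : t ≤ T)
    (hl : 2 ≤ Real.log T) (hlt : 2 * Real.log T ^ 3 ≤ t) :
    relax N M Q T t ≤ 8 * M * Real.log T ^ (5 / 2 : ℝ) * (N : ℝ) ^ (1 / 3 : ℝ) *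
      (t : ℝ) ^ (-(1 / 3) : ℝ) := by
  set l := Real.log T with hl'
  have hl0 : 0 < l := by linarith
  have ht1 : 1 ≤ t := by omega
  have ht0 : (0 : ℝ) < t := by exact_mod_cast ht1
  have hT0 : (0 : ℝ) < T := by exact_mod_cast (by omega : 0 < T)
  have hN0 : (0 : ℝ) < N := by exact_mod_cast hN
  have hN1 : (1 : ℝ) ≤ N := by exact_mod_cast hN
  have hQ1 : (1 : ℝ) ≤ Q := by exact_mod_cast hQ
  rw [rpow_neg_third ht0.le]
  set s : ℝ := (t : ℝ) ^ (1 / 3 : ℝ) with hs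
  set n : ℝ := (N : ℝ) ^ (1 / 3 : ℝ) with hn
  have hs0 : 0 < s := by positivity
  have hn1 : 1 ≤ n := Real.one_le_rpow hN1 (by norm_num)
  have hs3 : s ^ 3 = t := rpow_third_pow ht0.le
  have hn3 : n ^ 3 = N := rpow_third_pow hN0.le
  have hns : n ≤ s := Real.rpow_le_rpow hN0.le (by exact_mod_cast ht) (by norm_num)
  set rl := Real.sqrt l with hrl
  have hrl2 : rl ^ 2 = l := Real.sq_sqrt hl0.le
  have hrl1 : 1 ≤ rl := Real.one_le_sqrt.2 (by linarith)
  have hpow : l ^ (5 / 2 : ℝ) = l * (l * rl) := by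
    rw [show (5 / 2 : ℝ) = 1 + (1 + 1 / 2) by norm_num, Real.rpow_add hl0, Real.rpow_add hl0,
      Real.rpow_one, hrl, Real.sqrt_eq_rpow]
  have he : (n ^ 2)⁻¹ * s⁻¹ ≤ explore N t := by
    refine le_min ?_ ?_
    · rw [← hn3, ← mul_inv]
      apply inv_anti₀ (by positivity)
      nlinarith [pow_pos (lt_of_lt_of_le one_pos hn1) 2]
    · rw [rpow_neg_third ht0.le, ← hs]
      have : (N : ℝ) ^ (-(2 / 3) : ℝ) = (n ^ 2)⁻¹ := by
        rw [Real.rpow_neg hN0.le, hn, ← Real.rpow_natCast, ← Real.rpow_mul hN0.le]; norm_num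
      rw [this]
  -- For `t ≥ 2 l ^ 3` the subtracted root is at most half of `t / l`.
  have hmax : t / (2 * l) ≤ max 1 (t / l - Real.sqrt (t * l / 2)) := by
    refine le_trans ?_ (le_max_right _ _)
    have : Real.sqrt (t * l / 2) ≤ t / (2 * l) := by
      rw [Real.sqrt_le_left (by positivity), div_pow, le_div_iff₀ (by positivity)]
      nlinarith [mul_le_mul_of_nonneg_left hlt ht0.le]
    have h2 : t / l = t / (2 * l) + t / (2 * l) := by field_simp; ring
    linarith
  have hsqrt : s / (n * (2 * rl)) ≤
      Real.sqrt (explore N t * max 1 (t / l - Real.sqrt (t * l / 2))) := by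
    refine Real.le_sqrt_of_sq_le ?_
    calc (s / (n * (2 * rl))) ^ 2 ≤ ((n ^ 2)⁻¹ * s⁻¹) * (t / (2 * l)) := by
          rw [← hs3, ← hrl2]
          have : (n ^ 2)⁻¹ * s⁻¹ * (s ^ 3 / (2 * rl ^ 2)) = s ^ 2 / (n ^ 2 * (2 * rl ^ 2)) := by
            field_simp
          rw [this, div_pow]
          apply div_le_div_of_nonneg_left (by positivity) (by positivity)
          nlinarith [sq_nonneg (n * rl)]
      _ ≤ _ := by
          have := explore_nonneg N t
          gcongr
  have hg1 : gammaY N T t ≤ 8 * (l * rl) * n * s⁻¹ := by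
    unfold gammaY
    rw [← hl']
    calc 2 * l / Real.sqrt (explore N t * max 1 (t / l - Real.sqrt (t * l / 2)))
        ≤ 2 * l / (s / (n * (2 * rl))) :=
          div_le_div_of_nonneg_left (by positivity) (by positivity) hsqrt
      _ = 4 * (l * rl) * n * s⁻¹ := by field_simp; ring
      _ ≤ _ := by
        have : 0 ≤ (l * rl) * n * s⁻¹ := by positivity
        linarith
  have hg2 : gammaP Q T ≤ 8 * (l * rl) * n * s⁻¹ := by
    have h1 : Real.sqrt (Real.log (3 * T)) ≤ (3 / 2) * rl := by
      rw [Real.sqrt_le_left (by positivity), Real.log_mul (by norm_num) hT0.ne', ← hl', mul_pow,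
        hrl2]
      have : Real.log 3 ≤ 3 - 1 := Real.log_le_sub_one_of_pos (by norm_num)
      linarith
    have h2 : s ≤ Real.sqrt (window Q T) := by
      refine Real.le_sqrt_of_sq_le ?_
      have h3 : s ^ 2 = (t : ℝ) ^ (2 / 3 : ℝ) := by
        rw [hs, ← Real.rpow_natCast, ← Real.rpow_mul ht0.le]; norm_num
      rw [h3]
      unfold window
      refine le_trans ?_ (Nat.le_ceil _)
      calc (t : ℝ) ^ (2 / 3 : ℝ) ≤ (T : ℝ) ^ (2 / 3 : ℝ) :=
            Real.rpow_le_rpow ht0.le (by exact_mod_cast htT) (by norm_num)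
        _ ≤ _ := le_mul_of_one_le_left (by positivity) hQ1
    unfold gammaP
    calc 5 * Real.sqrt (Real.log (3 * T)) / Real.sqrt (window Q T)
        ≤ 5 * ((3 / 2) * rl) / s := by gcongr
      _ ≤ 8 * rl * s⁻¹ := by
        rw [← div_eq_mul_inv]; exact div_le_div_of_nonneg_right (by linarith) hs0.le
      _ = 8 * (1 * rl) * 1 * s⁻¹ := by ring
      _ ≤ _ := by gcongr; linarith
  unfold relax
  rw [← hl', hpow]
  calc M * l * max (gammaY N T t) (gammaP Q T) ≤ M * l * (8 * (l * rl) * n * s⁻¹) := by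
        gcongr; exact max_le hg1 hg2
    _ = _ := by ring

/-- The only source of "sufficiently large `T`". The power `4` is that of the logarithms in `ρ η`,
one from `ρ` and `5 / 2`, rounded up to `3`, from `η`; the gain against them is `t ^ (1/3) ≥ T ^
(1/6)`. -/
lemma eventually_log_large (C : ℝ) : ∃ T₀ : ℕ, ∀ T : ℕ, T₀ ≤ T → C ≤ Real.log T ∧
    C * Real.log T ^ 4 ≤ (T : ℝ) ^ (1 / 6 : ℝ) := by
  have h1 : Filter.Tendsto (fun T : ℕ => Real.log T) Filter.atTop Filter.atTop :=
    Real.tendsto_log_atTop.comp tendsto_natCast_atTop_atTop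
  have h2 := (isLittleO_log_rpow_rpow_atTop (s := (1 / 6 : ℝ)) (4 : ℝ) (by norm_num))
  have h3 := (h2.comp_tendsto (tendsto_natCast_atTop_atTop (R := ℝ))).bound
    (show (0 : ℝ) < 1 / (|C| + 1) by positivity)
  have h4 := (h1.eventually_ge_atTop C).and ((h1.eventually_ge_atTop 0).and h3)
  obtain ⟨T₀, hT₀⟩ := Filter.eventually_atTop.1 h4
  refine ⟨T₀, fun T hT => ?_⟩
  obtain ⟨a, b, c⟩ := hT₀ T hT
  refine ⟨a, ?_⟩
  simp only [Function.comp_apply] at c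
  rw [Real.norm_of_nonneg (by positivity), Real.norm_of_nonneg (by positivity),
    show (4 : ℝ) = ((4 : ℕ) : ℝ) by norm_num, Real.rpow_natCast, one_div_mul_eq_div,
    le_div_iff₀ (by positivity)] at c
  have : 0 ≤ Real.log T ^ 4 := by positivity
  nlinarith [le_abs_self C]

end Rates

/-! ### Averaging the losses over the rounds -/

section Averaging

variable {N M : ℕ} {parr : ℕ → Fin M → ℝ} {y : Fin N → Fin M → ℝ}
  {xhat : History N M → Fin N → Fin M → ℝ}

lemma one_le_mul_explore {N k : ℕ} (hN : 0 < N) (hk : N ≤ k) : 1 ≤ k * explore N k := by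
  have hN0 : (0 : ℝ) < N := by exact_mod_cast hN
  have hk0 : (0 : ℝ) < k := by exact_mod_cast (by omega : 0 < k)
  have hNk : (N : ℝ) ≤ k := by exact_mod_cast hk
  unfold explore
  rw [mul_min_of_nonneg _ _ hk0.le]
  refine le_min ?_ ?_
  · rw [← div_eq_mul_inv, le_div_iff₀ hN0]; linarith
  · have h1 : (k : ℝ) ^ (-(2 / 3) : ℝ) ≤ (N : ℝ) ^ (-(2 / 3) : ℝ) :=
      Real.rpow_le_rpow_of_nonpos hN0 hNk (by norm_num)
    have h2 : (k : ℝ) * ((k : ℝ) ^ (-(2 / 3) : ℝ) * (k : ℝ) ^ (-(1 / 3) : ℝ)) = 1 := by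
      rw [← Real.rpow_add hk0]; norm_num
      rw [Real.rpow_neg_one]; field_simp
    calc (1 : ℝ) = k * ((k : ℝ) ^ (-(2 / 3) : ℝ) * (k : ℝ) ^ (-(1 / 3) : ℝ)) := h2.symm
      _ ≤ _ := by gcongr

open Classical in
/-- The expectation of a time average whose terms are small after concentrated histories. -/
lemma expect_average_le (hp : ∀ t, parr t ∈ stdSimplex ℝ (Fin M))
    (hy : ∀ i j, y i j ∈ Set.Ioo (0 : ℝ) 1) (hx : ∀ h, xhat h ∈ recommendations N M)
    (hN : 0 < N) {T w : ℕ} (hT : 0 < T) (hw : 1 ≤ w) (hk : ∀ k < T, T ≤ k ^ 2 → N ≤ k)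
    {b B : ℝ} (hb : 0 ≤ b) (hB : 0 ≤ B) {F : History N M → ℝ}
    (hF : ∀ h, h.length = T → F h ≤ 1 / (T : ℝ) * ∑ k ∈ Finset.range T,
      (b * ((k + 1 : ℕ) : ℝ) ^ (-(1 / 3) : ℝ) +
        B * if T ≤ k ^ 2 ∧ Concentrated parr y xhat w (Real.log T) (h.drop (T - k))
          then 0 else 1)) :
    expect parr y xhat T F ≤ 1 / (T : ℝ) *
      (b * (2 * (T : ℝ) ^ (2 / 3 : ℝ)) + B * (Real.sqrt T + 1 + (6 * N * M + 12 * M))) := by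
  have hT0 : (0 : ℝ) < T := by exact_mod_cast hT
  refine (expect_mono hp hy hx T hF).trans ?_
  rw [expect_const_mul]
  refine mul_le_mul_of_nonneg_left ?_ (by positivity)
  rw [expect_sum]
  have hterm : ∀ k ∈ Finset.range T, expect parr y xhat T (fun h =>
      b * ((k + 1 : ℕ) : ℝ) ^ (-(1 / 3) : ℝ) +
        B * if T ≤ k ^ 2 ∧ Concentrated parr y xhat w (Real.log T) (h.drop (T - k))
          then 0 else 1) ≤
      b * ((k + 1 : ℕ) : ℝ) ^ (-(1 / 3) : ℝ) +
        B * ((if k ^ 2 < T then 1 else 0) + (6 * N * M + 12 * M) * (1 / (T : ℝ))) := by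
    intro k hkT
    rw [Finset.mem_range] at hkT
    rw [expect_add, expect_const hp hx, expect_const_mul]
    have h1 := expect_drop (y := y) hp hx k (T - k) (fun h =>
      if T ≤ k ^ 2 ∧ Concentrated parr y xhat w (Real.log T) h then (0 : ℝ) else 1)
    rw [Nat.add_sub_cancel' hkT.le] at h1
    rw [h1]
    gcongr
    by_cases hlt : k ^ 2 < T
    · rw [if_pos hlt]
      have h2 : expect parr y xhat k (fun h =>
          if T ≤ k ^ 2 ∧ Concentrated parr y xhat w (Real.log T) h then (0 : ℝ) else 1) ≤ 1 := by
        refine (expect_mono hp hy hx k (G := fun _ => 1) fun h _ => ?_).trans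
          (expect_const hp hx k 1).le
        split_ifs <;> norm_num
      have : (0 : ℝ) ≤ (6 * N * M + 12 * M) * (1 / (T : ℝ)) := by positivity
      linarith
    · rw [if_neg hlt, zero_add]
      have hTk : T ≤ k ^ 2 := not_lt.1 hlt
      have hNk := hk k hkT hTk
      simp only [hTk, true_and]
      have h3 := expect_not_concentrated_le hp hy hx (by omega) hw
        (one_le_mul_explore hN hNk) (Real.log T)
      -- The confidence level `log T` turns the failure probability into a multiple of `1 / T`, so
      -- the failures of all rounds sum to a constant.
      rwa [Real.exp_neg, Real.exp_log hT0, ← one_div] at h3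
  refine (Finset.sum_le_sum hterm).trans ?_
  rw [Finset.sum_add_distrib, ← Finset.mul_sum, ← Finset.mul_sum, Finset.sum_add_distrib]
  have h1 := sum_rpow_neg_third_le T
  have h2 : ∑ k ∈ Finset.range T, (if k ^ 2 < T then (1 : ℝ) else 0) ≤ Real.sqrt T + 1 := by
    rw [Finset.sum_ite, Finset.sum_const_zero, add_zero, Finset.sum_const, nsmul_eq_mul, mul_one]
    have h3 : (Finset.range T).filter (fun k => k ^ 2 < T) ⊆ Finset.range (Nat.sqrt T + 1) := by
      intro k hk
      rw [Finset.mem_filter] at hk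
      rw [Finset.mem_range, Nat.lt_succ_iff, Nat.le_sqrt']
      exact hk.2.le
    have h4 := Finset.card_le_card h3
    rw [Finset.card_range] at h4
    have h5 : (((Finset.range T).filter (fun k => k ^ 2 < T)).card : ℝ) ≤ Nat.sqrt T + 1 := by
      exact_mod_cast h4
    linarith [Real.nat_sqrt_le_real_sqrt (a := T)]
  have h3 : ∑ _k ∈ Finset.range T, (6 * N * M + 12 * M : ℝ) * (1 / (T : ℝ)) =
      6 * N * M + 12 * M := by
    rw [Finset.sum_const, Finset.card_range, nsmul_eq_mul]; field_simp
  rw [h3]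
  gcongr

end Averaging

/-! ### Ingredients for a single round -/

section Rounds

variable {N M : ℕ}

lemma rev_sub_rev_xRec_le {θ : Instance N M} (hθ : θ ∈ instances N M) (hN : 0 < N)
    {xhat : History N M → Fin N → Fin M → ℝ} {h : History N M}
    (hx : xhat h ∈ recommendations N M) :
    rev (xhat h) θ - rev (xRec xhat h) θ ≤
      ‖θ.r‖ * ((N : ℝ) ^ (1 / 3 : ℝ) * ((h.length + 1 : ℕ) : ℝ) ^ (-(1 / 3) : ℝ)) := by
  have h1 := explore_mul_le N hN (h.length + 1)
  have h2 : rev (xRec xhat h) θ = (1 - N * explore N (h.length + 1)) * rev (xhat h) θ +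
      explore N (h.length + 1) * rev (fun _ _ => 1) θ := by
    simp only [rev, xRec, Finset.mul_sum, ← Finset.sum_add_distrib]
    exact Finset.sum_congr rfl fun i _ => Finset.sum_congr rfl fun j _ => by ring
  have h3 : 0 ≤ explore N (h.length + 1) * rev (fun _ _ => 1) θ :=
    mul_nonneg (explore_nonneg _ _) (rev_nonneg hθ fun _ _ => zero_le_one)
  have h4 := rev_le hθ hx
  have h5 : N * explore N (h.length + 1) * rev (xhat h) θ ≤
      N * explore N (h.length + 1) * ‖θ.r‖ :=
    mul_le_mul_of_nonneg_left h4 (mul_nonneg (by positivity) (explore_nonneg _ _))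
  have h6 := mul_le_mul_of_nonneg_left h1 (norm_nonneg θ.r)
  rw [h2]
  linarith

/-- The factor `N` is crude; it is absorbed by a spare logarithm in the fairness bound. The revenue
bound uses `rev_sub_rev_xRec_le` instead. -/
lemma abs_xRec_sub_le (hN : 0 < N) {xhat : History N M → Fin N → Fin M → ℝ} {h : History N M}
    (hx : xhat h ∈ recommendations N M) (i : Fin N) (j : Fin M) :
    |xRec xhat h i j - xhat h i j| ≤
      N * ((h.length + 1 : ℕ) : ℝ) ^ (-(1 / 3) : ℝ) := by
  have hN1 : (1 : ℝ) ≤ N := by exact_mod_cast hN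
  have h0 := explore_nonneg N (h.length + 1)
  have hm := recommendations_mem_Icc hx i j
  have h1 : explore N (h.length + 1) ≤ ((h.length + 1 : ℕ) : ℝ) ^ (-(1 / 3) : ℝ) :=
    (min_le_right _ _).trans (mul_le_of_le_one_left (by positivity)
      (Real.rpow_le_one_of_one_le_of_nonpos hN1 (by norm_num)))
  refine le_trans ?_ (mul_le_mul_of_nonneg_left h1 (by positivity))
  have h2 : xRec xhat h i j - xhat h i j =
      explore N (h.length + 1) - N * explore N (h.length + 1) * xhat h i j := by
    simp only [xRec]; ring
  have h3 : 0 ≤ N * explore N (h.length + 1) := by positivity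
  have h4 := mul_le_mul_of_nonneg_left hm.2 h3
  have h5 := mul_nonneg h3 hm.1
  have h6 := mul_le_mul_of_nonneg_right hN1 h0
  rw [h2, abs_le]
  constructor <;> linarith

lemma exists_violation_le (S : Spec N M) (θ : Instance N M) :
    ∃ V : ℝ, 0 ≤ V ∧ ∀ x ∈ recommendations N M, ∀ k, violation S θ x k ≤ V := by
  refine ⟨∑ k, |violation S θ 0 k| + (M * ‖S.L θ‖ + N * ‖S.U θ‖) * 1, by positivity, ?_⟩
  intro x hx k
  have h1 := abs_le.1 (abs_violation_sub_le S θ (x := x) (x' := 0) zero_le_one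
    (fun i j => by simpa using recommendations_abs_le hx i j) k)
  have h2 := Finset.single_le_sum (f := fun k => |violation S θ 0 k|)
    (fun _ _ => abs_nonneg _) (Finset.mem_univ k)
  have h3 := le_abs_self (violation S θ 0 k)
  linarith [h1.2]

/-- The algorithm optimizes only when its estimate lies in `Θ`, so the estimates of `y` must be kept
inside the open interval. -/
lemma exists_margin {y : Fin N → Fin M → ℝ} (hy : ∀ i j, y i j ∈ Set.Ioo (0 : ℝ) 1) :
    ∃ μ : ℝ, 0 < μ ∧ ∀ y' : Fin N → Fin M → ℝ, (∀ i j, |y' i j - y i j| ≤ μ) →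
      ∀ i j, y' i j ∈ Set.Ioo (0 : ℝ) 1 := by
  have hev : ∀ᶠ μ in nhdsWithin (0 : ℝ) (Set.Ioi 0), ∀ p : Fin N × Fin M,
      μ < y p.1 p.2 ∧ μ < 1 - y p.1 p.2 := by
    rw [Filter.eventually_all]
    intro p
    have := hy p.1 p.2
    filter_upwards [nhdsWithin_le_nhds (Iio_mem_nhds this.1),
      nhdsWithin_le_nhds (Iio_mem_nhds (sub_pos.2 this.2))] with μ h1 h2 using ⟨h1, h2⟩
  obtain ⟨μ, h1, h2⟩ := (hev.and self_mem_nhdsWithin).exists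
  refine ⟨μ, h2, fun y' hy' i j => ?_⟩
  have h3 := abs_le.1 (hy' i j)
  have h4 := h1 (i, j)
  simp only at h4
  exact ⟨by linarith [h3.1, h4.1], by linarith [h3.2, h4.2]⟩

lemma norm_instance_sub_le {p p' : Fin M → ℝ} {y y' : Fin N → Fin M → ℝ} {r : Fin N → ℝ} {c : ℝ}
    (hc : 0 ≤ c) (hp : ∀ j, |p j - p' j| ≤ c) (hy : ∀ i j, |y i j - y' i j| ≤ c) :
    ‖((p, y, r) : Instance N M) - (p', y', r)‖ ≤ c := by
  simp only [Prod.mk_sub_mk, sub_self]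
  refine norm_prod_le_iff.2 ⟨(pi_norm_le_iff_of_nonneg hc).2 hp, norm_prod_le_iff.2
    ⟨(pi_norm_le_iff_of_nonneg hc).2 fun i => (pi_norm_le_iff_of_nonneg hc).2 (hy i), ?_⟩⟩
  simpa using hc

lemma exists_pos_lower_bound {p : Fin M → ℝ} (hp : ∀ j, 0 < p j) :
    ∃ c : ℝ, 0 < c ∧ ∀ j, c ≤ p j := by
  have hev : ∀ᶠ c in nhdsWithin (0 : ℝ) (Set.Ioi 0), ∀ j, c < p j := by
    rw [Filter.eventually_all]
    exact fun j => nhdsWithin_le_nhds (Iio_mem_nhds (hp j))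
  obtain ⟨c, h1, h2⟩ := (hev.and self_mem_nhdsWithin).exists
  exact ⟨c, h2, fun j => (h1 j).le⟩

/-- Elementary consequences of `T` being large for a round `k + 1` with `√T ≤ k < T`, where
`v = T ^ (1 / 6)` and `s = (k + 1) ^ (1 / 3)`. -/
lemma round_scales {T k : ℕ} (hkT : k < T) (hTk : T ≤ k ^ 2) (hv1 : 1 ≤ (T : ℝ) ^ (1 / 6 : ℝ)) :
    (T : ℝ) ^ (1 / 6 : ℝ) ≤ ((k + 1 : ℕ) : ℝ) ^ (1 / 3 : ℝ) ∧
    ((k + 1 : ℕ) : ℝ) ^ (1 / 3 : ℝ) ≤ ((T : ℝ) ^ (1 / 6 : ℝ)) ^ 2 ∧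
    (T : ℝ) ^ (1 / 6 : ℝ) ≤ k ∧ ((T : ℝ) ^ (1 / 6 : ℝ)) ^ 2 ≤ k := by
  have hT0 : (0 : ℝ) ≤ T := by positivity
  set v := (T : ℝ) ^ (1 / 6 : ℝ) with hv
  have hv6 : v ^ 6 = T := by
    rw [hv, ← Real.rpow_natCast, ← Real.rpow_mul hT0]; norm_num
  have hv3 : v ^ 3 ≤ k := by
    refine le_of_sq_le_sq ?_ (by positivity)
    rw [← pow_mul, hv6]; exact_mod_cast hTk
  have hv2 : v ^ 2 ≤ v ^ 3 := pow_le_pow_right₀ hv1 (by norm_num)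
  have hv2' : v ≤ v ^ 2 := by nlinarith
  set s := ((k + 1 : ℕ) : ℝ) ^ (1 / 3 : ℝ) with hs
  have hs0 : 0 ≤ s := by positivity
  have hs3 : s ^ 3 = ((k + 1 : ℕ) : ℝ) := rpow_third_pow (by positivity)
  refine ⟨?_, ?_, by linarith, by linarith⟩
  · refine le_of_pow_le_pow_left₀ (n := 3) (by norm_num) hs0 ?_
    rw [hs3]; push_cast; linarith
  · refine le_of_pow_le_pow_left₀ (n := 3) (by norm_num) (by positivity) ?_
    rw [hs3, ← pow_mul, hv6]; exact_mod_cast hkT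

end Rounds

/-! ### The loss of one round -/

/-- After a concentrated history the estimated instance is an instance close to the true one. -/
lemma thetaHat_mem_and_norm_sub_le {N M Q T : ℕ} (hN : 0 < N) (hQ : 0 < Q)
    {parr : ℕ → Fin M → ℝ} (hp : ∀ t, parr t ∈ stdSimplex ℝ (Fin M))
    (hper : ∀ t, parr (t + Q) = parr t)
    {y : Fin N → Fin M → ℝ} {r : Fin N → ℝ} (hr : ∀ i, 0 < r i) {pm μ ζ l : ℝ} (hpm : 0 < pm)
    (hpm' : ∀ j, pm ≤ meanArrival parr Q j) (hζ : 0 < ζ) (hζμ : ζ ≤ μ)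
    (hmargin : ∀ y' : Fin N → Fin M → ℝ, (∀ i j, |y' i j - y i j| ≤ μ) →
      ∀ i j, y' i j ∈ Set.Ioo (0 : ℝ) 1)
    {xhat : History N M → Fin N → Fin M → ℝ} {h : History N M} (hhT : h.length < T)
    (hTh : T ≤ h.length ^ 2) (hl : 1 ≤ l)
    (hv1 : 1 ≤ (T : ℝ) ^ (1 / 6 : ℝ)) (hNv : (N : ℝ) ≤ (T : ℝ) ^ (1 / 6 : ℝ))
    (h₁ : 4 / pm * l ≤ (T : ℝ) ^ (1 / 6 : ℝ)) (h₂ : 4 * Q / pm ≤ (T : ℝ) ^ (1 / 6 : ℝ))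
    (h₃ : 2 * (2 * N / pm + 1 + 2 * Q) / ζ * l ≤ (T : ℝ) ^ (1 / 6 : ℝ))
    (hconc : Concentrated parr y xhat (window Q T) l h) :
    thetaHat (window Q T) r xhat h ∈ instances N M ∧
      ‖thetaHat (window Q T) r xhat h - (meanArrival parr Q, y, r)‖ ≤
        2 * (2 * N / pm + 1 + 2 * Q) * l * ((h.length + 1 : ℕ) : ℝ) ^ (-(1 / 3) : ℝ) ∧
      2 * (2 * N / pm + 1 + 2 * Q) * l * ((h.length + 1 : ℕ) : ℝ) ^ (-(1 / 3) : ℝ) ≤ ζ := by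
  obtain ⟨hvs, -, hvk, hv2k⟩ := round_scales hhT hTh hv1
  generalize hv : (T : ℝ) ^ (1 / 6 : ℝ) = v at *
  generalize hk : h.length = k at *
  have hk1' : (1 : ℝ) ≤ k := hv1.trans hvk
  have hk1 : 1 ≤ k := by exact_mod_cast hk1'
  have hk0 : (0 : ℝ) < k := by linarith
  have hNk : N ≤ k := by exact_mod_cast hNv.trans hvk
  have ht0 : (0 : ℝ) ≤ ((k + 1 : ℕ) : ℝ) := by positivity
  have hwin : (k : ℝ) ^ (2 / 3 : ℝ) ≤ window Q T := by
    unfold window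
    refine le_trans ?_ (Nat.le_ceil _)
    calc (k : ℝ) ^ (2 / 3 : ℝ) ≤ (T : ℝ) ^ (2 / 3 : ℝ) :=
          Real.rpow_le_rpow hk0.le (by exact_mod_cast hhT.le) (by norm_num)
      _ ≤ _ := le_mul_of_one_le_left (by positivity) (by exact_mod_cast hQ)
  have hwin1 : 1 ≤ window Q T := by
    have : (1 : ℝ) ≤ (k : ℝ) ^ (2 / 3 : ℝ) := Real.one_le_rpow hk1' (by norm_num)
    exact_mod_cast this.trans hwin
  have hlarge : Q + l * Real.sqrt k ≤ k * (pm / 2) := by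
    have h2 : v ≤ Real.sqrt k := Real.le_sqrt_of_sq_le hv2k
    rw [div_mul_eq_mul_div, div_le_iff₀ hpm] at h₁
    rw [div_le_iff₀ hpm] at h₂
    have h4 : Real.sqrt k * Real.sqrt k = k := Real.mul_self_sqrt hk0.le
    have h5 := mul_le_mul_of_nonneg_right h2 hpm.le
    have h6 := mul_le_mul_of_nonneg_right (h₁.trans h5) (Real.sqrt_nonneg k)
    have h7 := mul_le_mul_of_nonneg_right hvk hpm.le
    have h8 : Real.sqrt k * pm * Real.sqrt k = k * pm := by rw [mul_right_comm, h4]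
    linarith
  subst hk
  obtain ⟨hyE, hpE⟩ := abs_estimate_sub_le hp hQ hper hl hpm hpm' hN hNk hwin hlarge hconc
  generalize hk : h.length = k at *
  -- The estimate uses `k` observations while the round has index `k + 1`; `k + 1 ≤ 8 k` costs a
  -- factor `8 ^ (1/3) = 2`.
  have hku : (k : ℝ) ^ (-(1 / 3) : ℝ) ≤ 2 * ((k + 1 : ℕ) : ℝ) ^ (-(1 / 3) : ℝ) := by
    have h1 : (8 * (k : ℝ)) ^ (-(1 / 3) : ℝ) ≤ ((k + 1 : ℕ) : ℝ) ^ (-(1 / 3) : ℝ) := by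
      refine Real.rpow_le_rpow_of_nonpos (by positivity) ?_ (by norm_num)
      push_cast; linarith
    rw [Real.mul_rpow (by norm_num) hk0.le] at h1
    have h2 : (8 : ℝ) ^ (-(1 / 3) : ℝ) = 1 / 2 := by
      rw [show (8 : ℝ) = 2 ^ (3 : ℝ) by norm_num, ← Real.rpow_mul (by norm_num)]
      norm_num
    rw [h2] at h1
    linarith
  rw [rpow_neg_third ht0] at hku ⊢
  generalize ((k + 1 : ℕ) : ℝ) ^ (1 / 3 : ℝ) = s at *
  have hs0 : 0 < s := by linarith
  have hK₀ : 0 < 2 * (2 * N / pm + 1 + 2 * Q : ℝ) := by positivity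
  have hE : (2 * N / pm + 1 + 2 * Q) * l * (k : ℝ) ^ (-(1 / 3) : ℝ) ≤
      2 * (2 * N / pm + 1 + 2 * Q) * l * s⁻¹ := by
    calc _ ≤ (2 * N / pm + 1 + 2 * Q) * l * (2 * s⁻¹) := by gcongr
      _ = _ := by ring
  have hρζ : 2 * (2 * N / pm + 1 + 2 * Q) * l * s⁻¹ ≤ ζ := by
    rw [div_mul_eq_mul_div, div_le_iff₀ hζ] at h₃
    rw [← div_eq_mul_inv, div_le_iff₀ hs0]
    refine h₃.trans ?_
    rw [mul_comm]; gcongr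
  refine ⟨⟨pHat_mem_stdSimplex hwin1 (by rw [hk]; exact hk1),
      hmargin _ fun i j => (hyE i j).trans (hE.trans (hρζ.trans hζμ)), hr⟩, ?_, hρζ⟩
  exact norm_instance_sub_le (by positivity) (fun j => (hpE j).trans hE)
    fun i j => (hyE i j).trans hE

/-- By periodicity the average up to `T` differs from the period average only through an incomplete
period. -/
lemma norm_meanArrival_sub_le {N M Q T : ℕ} (hQ : 0 < Q) (hT : 0 < T) {parr : ℕ → Fin M → ℝ}
    (hp : ∀ t, parr t ∈ stdSimplex ℝ (Fin M)) (hper : ∀ t, parr (t + Q) = parr t)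
    (y : Fin N → Fin M → ℝ) (r : Fin N → ℝ) :
    ‖((meanArrival parr T, y, r) : Instance N M) - (meanArrival parr Q, y, r)‖ ≤ Q / T := by
  have hTpos : (0 : ℝ) < T := by exact_mod_cast hT
  have h0 : (0 : ℝ) ≤ Q / T := by positivity
  refine norm_instance_sub_le h0 (fun j => ?_) fun i j => by simpa using h0
  have h1 := abs_sum_arrival_sub_le hp hQ hper j T
  rw [meanArrival_eq T]
  have h2 : 1 / (T : ℝ) * ∑ k ∈ Finset.range T, parr (k + 1) j - meanArrival parr Q j =
      (∑ k ∈ Finset.range T, parr (k + 1) j - T * meanArrival parr Q j) / T := by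
    field_simp
  rw [h2, abs_div, abs_of_pos hTpos]
  exact div_le_div_of_nonneg_right h1 hTpos.le

/-- The error terms of the revenue loss of one round are dominated by `R * u`. -/
lemma revenue_error_le {K K₀ Q R M N l p n u v τ η : ℝ} (hK : 0 ≤ K) (hK₀ : 0 ≤ K₀) (hR : 0 < R)
    (hM : 0 ≤ M) (hl : 1 ≤ l) (hpl : p ≤ l ^ 3) (hn0 : 0 ≤ n) (hn : n ≤ N) (hu : 0 < u)
    (hv : 1 ≤ v) (hvu : v * u ≤ 1) (huv : 1 ≤ v ^ 2 * u) (hτ : τ = Q / v ^ 6)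
    (hη : η ≤ 8 * M * p * n * u) (h₁ : 2 * K * Q / R ≤ v)
    (h₂ : 16 * M * N * K * K₀ / R * l ^ 4 ≤ v) :
    K * τ + K * (K₀ * l * u * η) ≤ R * u := by
  have hv0 : 0 < v := by linarith
  -- Half of `R * u` is reserved for each term. Since `v⁻² ≤ u ≤ v⁻¹`, the first term, of order
  -- `v⁻⁶`, is far below `u`, and the second, of order `l ^ 4 u ^ 2`, is at most `l ^ 4 u / v`.
  have h2 : K * τ ≤ R / 2 * u := by
    rw [div_le_iff₀ hR] at h₁
    have h4 : v ≤ u * v ^ 6 := by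
      calc v = v * 1 := (mul_one v).symm
        _ ≤ v * (v ^ 2 * u) := by gcongr
        _ = v ^ 3 * u := by ring
        _ ≤ v ^ 6 * u := by
          have : v ^ 3 ≤ v ^ 6 := pow_le_pow_right₀ hv (by norm_num)
          gcongr
        _ = u * v ^ 6 := mul_comm _ _
    have h5 := mul_le_mul_of_nonneg_right h4 hR.le
    rw [hτ, mul_div_assoc', div_le_iff₀ (by positivity)]
    linarith
  have h3 : K * (K₀ * l * u * η) ≤ R / 2 * u := by
    rw [div_mul_eq_mul_div, div_le_iff₀ hR] at h₂
    have hη' : η ≤ 8 * M * l ^ 3 * N * u := hη.trans (by gcongr)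
    calc K * (K₀ * l * u * η) ≤ K * (K₀ * l * u * (8 * M * l ^ 3 * N * u)) := by gcongr
      _ = 1 / 2 * (16 * M * N * K * K₀ * l ^ 4) * (u * u) := by ring
      _ ≤ 1 / 2 * (v * R) * (u * u) := by gcongr
      _ = R / 2 * u * (v * u) := by ring
      _ ≤ R / 2 * u * 1 := by gcongr
      _ = _ := mul_one _
  linarith

/-- Bounds for the rounds of one run: small losses after concentrated histories of sufficient
length, bounded losses always. -/
lemma exists_round_bound {N M Q : ℕ} (hN : 0 < N) (hM : 0 < M) (hQ : 0 < Q)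
    {parr : ℕ → Fin M → ℝ} (hp : ∀ t, parr t ∈ stdSimplex ℝ (Fin M))
    (hper : ∀ t, parr (t + Q) = parr t) (hpos : ∀ j, 0 < meanArrival parr Q j)
    {y : Fin N → Fin M → ℝ} (hy : ∀ i j, y i j ∈ Set.Ioo (0 : ℝ) 1)
    {r : Fin N → ℝ} (hr : ∀ i, 0 < r i) {S : Spec N M} (hS : S.Valid)
    (hL : S.LocallyLipschitzAt (meanArrival parr Q, y, r)) :
    ∃ V : ℝ, 0 ≤ V ∧ ∀ D : ℝ, ∃ T₀ : ℕ, ∀ T : ℕ, T₀ ≤ T →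
      (D ≤ (T : ℝ) ^ (1 / 6 : ℝ) ∧ 1 ≤ Real.log T) ∧
      (meanArrival parr T, y, r) ∈ instances N M ∧
      (∀ k < T, T ≤ k ^ 2 → N ≤ k) ∧
      ∀ xhat : History N M → Fin N → Fin M → ℝ, IsFORM S r Q T xhat →
      ∀ xstar : Fin N → Fin M → ℝ, S.IsOptimal (meanArrival parr T, y, r) 0 xstar →
      (∀ h : History N M, ∀ k, violation S (meanArrival parr T, y, r) (xRec xhat h) k ≤ V) ∧
      ∀ h : History N M, h.length < T → T ≤ h.length ^ 2 →
        Concentrated parr y xhat (window Q T) (Real.log T) h →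
        rev xstar (meanArrival parr T, y, r) - rev (xRec xhat h) (meanArrival parr T, y, r) ≤
          2 * ‖r‖ * (N : ℝ) ^ (1 / 3 : ℝ) * ((h.length + 1 : ℕ) : ℝ) ^ (-(1 / 3) : ℝ) ∧
        ∀ k, violation S (meanArrival parr T, y, r) (xRec xhat h) k ≤
          9 * M * Real.log T ^ (5 / 2 : ℝ) * (N : ℝ) ^ (1 / 3 : ℝ) *
            ((h.length + 1 : ℕ) : ℝ) ^ (-(1 / 3) : ℝ) := by
  have hθ₀mem : ((meanArrival parr Q, y, r) : Instance N M) ∈ instances N M :=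
    ⟨meanArrival_mem hp hQ, hy, hr⟩
  have hN0 : (0 : ℝ) < N := by exact_mod_cast hN
  have hN1 : (1 : ℝ) ≤ N := by exact_mod_cast hN
  have hM1 : (1 : ℝ) ≤ M := by exact_mod_cast hM
  have hQ0 : (0 : ℝ) < Q := by exact_mod_cast hQ
  have hR0 : 0 < ‖r‖ := norm_pos_iff.2 fun h => by
    have := hr ⟨0, hN⟩; rw [h] at this; simp at this
  obtain ⟨pm, hpm, hpm'⟩ := exists_pos_lower_bound hpos
  obtain ⟨μ, hμ, hmargin⟩ := exists_margin hy
  obtain ⟨K₁, ζ₁, hK₁, hζ₁, hLip⟩ := exists_violation_lipschitz hS hθ₀mem hL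
  obtain ⟨K₂, ζ₂, hK₂, hζ₂, hPert⟩ := exists_perturbation_bound hS hθ₀mem hL
  obtain ⟨V, hV, hVle⟩ := exists_violation_le S (meanArrival parr Q, y, r)
  have hviolx := fun x x' b hb0 hb k =>
    abs_violation_sub_le S (meanArrival parr Q, y, r) (x := x) (x' := x') (b := b) hb0 hb k
  have hA0 : 0 ≤ M * ‖S.L (meanArrival parr Q, y, r)‖ + N * ‖S.U (meanArrival parr Q, y, r)‖ := by
    positivity
  generalize M * ‖S.L (meanArrival parr Q, y, r)‖ + N * ‖S.U (meanArrival parr Q, y, r)‖ = A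
    at hA0 hviolx
  have hest := fun (T : ℕ) (ζ l : ℝ) (xhat : History N M → Fin N → Fin M → ℝ) (h : History N M)
      (a : 0 < ζ) (b : ζ ≤ μ) (c : h.length < T) (d : T ≤ h.length ^ 2) =>
    thetaHat_mem_and_norm_sub_le (l := l) (xhat := xhat) hN hQ hp hper hr hpm hpm' a b hmargin c d
  have hK₀0 : 0 < 2 * (2 * N / pm + 1 + 2 * Q : ℝ) := by positivity
  generalize 2 * (2 * N / pm + 1 + 2 * Q : ℝ) = K₀ at hK₀0 hest
  -- `V` bounds the violations at `θ₀`; the summand `K₁ ζ₁` transfers the bound to `θ_T`, uniformly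
  -- in `T`.
  refine ⟨V + K₁ * ζ₁, by positivity, fun D => ?_⟩
  obtain ⟨ζ, hζ, hζ1, hζ2, hζμ⟩ : ∃ ζ : ℝ, 0 < ζ ∧ ζ ≤ ζ₁ ∧ ζ ≤ ζ₂ ∧ ζ ≤ μ :=
    ⟨min (min ζ₁ ζ₂) μ, lt_min (lt_min hζ₁ hζ₂) hμ, (min_le_left _ _).trans (min_le_left _ _),
      (min_le_left _ _).trans (min_le_right _ _), min_le_right _ _⟩
  -- One constant above all instance-dependent ones, so that `C ≤ log T` and `C (log T) ^ 4 ≤ T ^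
  -- (1/6)` yield every later comparison.
  obtain ⟨C, hC2, hCN, q1, q2, q3, q4, q6, q7, q8, q9⟩ : ∃ C : ℝ, 2 ≤ C ∧ N ≤ C ∧ 4 / pm ≤ C ∧
      4 * Q / pm ≤ C ∧ K₀ / ζ ≤ C ∧ Q / ζ ≤ C ∧ 2 * K₂ * Q / ‖r‖ ≤ C ∧
      16 * M * N * K₂ * K₀ / ‖r‖ ≤ C ∧ K₂ * (K₀ + Q) + 2 * (K₁ * Q) + A * N ≤ C ∧ |D| ≤ C := by
    have p1 : 0 ≤ 4 / pm := by positivity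
    have p2 : 0 ≤ 4 * Q / pm := by positivity
    have p3 : 0 ≤ K₀ / ζ := by positivity
    have p4 : 0 ≤ Q / ζ := by positivity
    have p6 : 0 ≤ 2 * K₂ * Q / ‖r‖ := by positivity
    have p7 : 0 ≤ 16 * M * N * K₂ * K₀ / ‖r‖ := by positivity
    have p8 : 0 ≤ K₂ * (K₀ + Q) + 2 * (K₁ * Q) + A * N := by positivity
    have p9 := abs_nonneg D
    refine ⟨2 + N + 4 / pm + 4 * Q / pm + K₀ / ζ + Q / ζ + 2 * K₂ * Q / ‖r‖ +
      16 * M * N * K₂ * K₀ / ‖r‖ + (K₂ * (K₀ + Q) + 2 * (K₁ * Q) + A * N) + |D|,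
      ?_, ?_, ?_, ?_, ?_, ?_, ?_, ?_, ?_, ?_⟩ <;> linarith only [p1, p2, p3, p4, p6, p7, p8, p9, hN0]
  obtain ⟨T₀, hT₀⟩ := eventually_log_large C
  refine ⟨max 1 T₀, fun T hT => ?_⟩
  obtain ⟨hl, hv⟩ := hT₀ T ((le_max_right _ _).trans hT)
  have hT1 : 1 ≤ T := (le_max_left _ _).trans hT
  have hTpos : (0 : ℝ) < T := by exact_mod_cast hT1
  have hv6 : ((T : ℝ) ^ (1 / 6 : ℝ)) ^ 6 = T := by
    rw [← Real.rpow_natCast, ← Real.rpow_mul hTpos.le]; norm_num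
  have hl1 : 1 ≤ Real.log T := by linarith only [hl, hC2]
  have hl2 : 1 ≤ Real.log T ^ 4 := one_le_pow₀ hl1
  have hl3 : Real.log T ≤ Real.log T ^ 4 := le_self_pow₀ hl1 (by norm_num)
  have hcl : ∀ c, c ≤ C → c * Real.log T ^ 4 ≤ (T : ℝ) ^ (1 / 6 : ℝ) := fun c hc' =>
    (mul_le_mul_of_nonneg_right hc' (by positivity)).trans hv
  have hCv : C ≤ (T : ℝ) ^ (1 / 6 : ℝ) :=
    (le_mul_of_one_le_right (by linarith only [hC2]) hl2).trans hv
  have hcl1 : ∀ c, 0 ≤ c → c ≤ C → c * Real.log T ≤ (T : ℝ) ^ (1 / 6 : ℝ) := fun c hc hc' =>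
    (mul_le_mul_of_nonneg_left hl3 hc).trans (hcl c hc')
  have hv1 : 1 ≤ (T : ℝ) ^ (1 / 6 : ℝ) := by linarith only [hCv, hC2]
  have hTv : (T : ℝ) ^ (1 / 6 : ℝ) ≤ T :=
    (le_self_pow₀ hv1 (by norm_num)).trans hv6.le
  have hθTmem : ((meanArrival parr T, y, r) : Instance N M) ∈ instances N M :=
    ⟨meanArrival_mem hp (by omega), hy, hr⟩
  have hτ := norm_meanArrival_sub_le hQ (by omega : 0 < T) hp hper y r
  have hτζ : (Q : ℝ) / T ≤ ζ := by
    rw [div_le_iff₀ hζ] at q4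
    rw [div_le_iff₀ hTpos, mul_comm]
    exact q4.trans (mul_le_mul_of_nonneg_right (hCv.trans hTv) hζ.le)
  have hLipT : ∀ x ∈ recommendations N M, ∀ k,
      |violation S (meanArrival parr T, y, r) x k - violation S (meanArrival parr Q, y, r) x k| ≤
        K₁ * (Q / T) := fun x hx k =>
    (hLip _ hθTmem (hτ.trans (hτζ.trans hζ1)) x hx k).trans (mul_le_mul_of_nonneg_left hτ hK₁)
  have hNv : (N : ℝ) ≤ (T : ℝ) ^ (1 / 6 : ℝ) := hCN.trans hCv
  refine ⟨⟨(le_abs_self D).trans (q9.trans hCv), hl1⟩, hθTmem, fun k hkT hTk => ?_,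
    fun xhat hF xstar hxs => ⟨fun h k => ?_, ?_⟩⟩
  · obtain ⟨-, -, h1, -⟩ := round_scales hkT hTk hv1
    exact_mod_cast hNv.trans h1
  · have hx := xRec_mem (hF h).1
    have h1 := (abs_le.1 (hLipT _ hx k)).2
    have h2 : K₁ * (Q / T) ≤ K₁ * ζ₁ := mul_le_mul_of_nonneg_left (hτζ.trans hζ1) hK₁
    linarith only [hVle _ hx k, h1, h2]
  intro h hhT hTh hconc
  obtain ⟨hvs, hsv, hvk, -⟩ := round_scales hhT hTh hv1
  obtain ⟨hθh, hρ, hρζ⟩ := hest T ζ (Real.log T) xhat h hζ hζμ hhT hTh hl1 hv1 hNv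
    (hcl1 _ (by positivity) q1) (q2.trans hCv) (hcl1 _ (by positivity) q3) hconc
  have hNk : N ≤ h.length := by exact_mod_cast hNv.trans hvk
  have ht0 : (0 : ℝ) ≤ ((h.length + 1 : ℕ) : ℝ) := by positivity
  have hus := rpow_neg_third ht0
  have hs0 : 0 < ((h.length + 1 : ℕ) : ℝ) ^ (1 / 3 : ℝ) := by positivity
  have hηlow := relax_lower (N := N) (M := M) (Q := Q) (t := h.length + 1) hN hM (by omega) hl1
  have hηup := relax_upper (M := M) (t := h.length + 1) hN hQ (by omega) hhT (hC2.trans hl) (by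
    have h1 := hcl 2 hC2
    have h2 : Real.log T ^ 3 ≤ Real.log T ^ 4 := pow_le_pow_right₀ hl1 (by norm_num)
    push_cast
    linarith only [h1, h2, hvk])
  obtain ⟨hxh, hxo⟩ := hF h
  have hPh := hPert _ hθTmem rfl _ hτ (hτζ.trans hζ2) xstar hxs _ hθh rfl _ hρ (hρζ.trans hζ2)
    (relax N M Q T (h.length + 1))
  have hexp := rev_sub_rev_xRec_le hθTmem hN hxh
  have hxRec := abs_xRec_sub_le hN hxh
  have hn1 : 1 ≤ (N : ℝ) ^ (1 / 3 : ℝ) := Real.one_le_rpow hN1 (by norm_num)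
  have hnN : (N : ℝ) ^ (1 / 3 : ℝ) ≤ N := by
    calc (N : ℝ) ^ (1 / 3 : ℝ) ≤ (N : ℝ) ^ (1 : ℝ) :=
          Real.rpow_le_rpow_of_exponent_le hN1 (by norm_num)
      _ = N := Real.rpow_one _
  have hl52 : Real.log T ^ 2 ≤ Real.log T ^ (5 / 2 : ℝ) := by
    rw [← Real.rpow_natCast]
    exact Real.rpow_le_rpow_of_exponent_le hl1 (by norm_num)
  have hl53 : Real.log T ^ (5 / 2 : ℝ) ≤ Real.log T ^ 3 := by
    rw [← Real.rpow_natCast]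
    exact Real.rpow_le_rpow_of_exponent_le hl1 (by norm_num)
  have hτeq : (Q : ℝ) / T = Q / ((T : ℝ) ^ (1 / 6 : ℝ)) ^ 6 := by rw [hv6]
  rw [show Instance.r ((meanArrival parr T, y, r) : Instance N M) = r from rfl] at hexp
  generalize relax N M Q T (h.length + 1) = η at *
  generalize ((h.length + 1 : ℕ) : ℝ) ^ (-(1 / 3) : ℝ) = u at *
  generalize ((h.length + 1 : ℕ) : ℝ) ^ (1 / 3 : ℝ) = s at *
  generalize Real.log T ^ (5 / 2 : ℝ) = lp at *
  generalize Real.log T = l at *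
  generalize (N : ℝ) ^ (1 / 3 : ℝ) = n at *
  generalize (T : ℝ) ^ (1 / 6 : ℝ) = v at *
  have hu0 : 0 < u := by rw [hus]; positivity
  have hsu : s * u = 1 := by rw [hus]; field_simp
  have hvu : v * u ≤ 1 := by rw [← hsu]; gcongr
  have huv : 1 ≤ v ^ 2 * u := by rw [← hsu]; gcongr
  have hl0 : 0 < l := by linarith only [hl1]
  have hlp : 0 ≤ lp := (sq_nonneg l).trans hl52
  have hulu : u ≤ l * u := le_mul_of_one_le_left hu0.le hl1
  have hτlu : (Q : ℝ) / T ≤ Q * (l * u) := by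
    rw [div_le_iff₀ hTpos, mul_assoc]
    refine le_mul_of_one_le_right hQ0.le ?_
    have h1 : v ^ 2 ≤ T := by rw [← hv6]; exact pow_le_pow_right₀ hv1 (by norm_num)
    calc 1 ≤ v ^ 2 * u := huv
      _ ≤ T * (l * u) := by gcongr
      _ = l * u * T := mul_comm _ _
  have hρτ : K₂ * (K₀ * l * u + Q / T) ≤ K₂ * (K₀ + Q) * (l * u) := by
    calc _ ≤ K₂ * (K₀ * l * u + Q * (l * u)) := by gcongr
      _ = _ := by ring
  have hK₁Q : 0 ≤ K₁ * Q := by positivity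
  have hAN : 0 ≤ A * N := by positivity
  -- Here `log T` outgrows the unknown constants, which is why the relaxation dominates the
  -- estimation error.
  have hc5 : K₂ * (K₀ + Q) ≤ l := by linarith only [q8, hl, hK₁Q, hAN]
  have hK2η : K₂ * (K₀ * l * u + Q / T) ≤ η := by
    refine (hρτ.trans ?_).trans hηlow
    calc K₂ * (K₀ + Q) * (l * u) ≤ l * (l * u) := by gcongr
      _ = l ^ 2 * u := by ring
  obtain ⟨hne, hopt⟩ := hPh hK2η
  obtain ⟨hrevb, hviolb⟩ := hopt _ (hxo hθh hne)
  constructor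
  · have h1 := revenue_error_le hK₂ hK₀0.le hR0 (by positivity : (0 : ℝ) ≤ M) hl1 hl53
      (by positivity) hnN hu0 hv1 hvu huv hτeq hηup (q6.trans hCv) (hcl _ q7)
    have h4 : ‖r‖ * u ≤ ‖r‖ * (n * u) := by
      have : u ≤ n * u := le_mul_of_one_le_left hu0.le hn1
      gcongr
    linarith only [h1, h4, hrevb, hexp]
  · intro q
    have h1 := (abs_le.1 (hLipT _ (xRec_mem hxh) q)).2
    have h2 := (abs_le.1 (hLipT _ hxh q)).1
    have h3 := (abs_le.1 (hviolx _ _ _ (by positivity) hxRec q)).2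
    have h4 := hviolb q
    have h5 : K₁ * (Q / T) ≤ K₁ * Q * (l * u) := by
      rw [mul_assoc]; gcongr
    have h6 : A * (N * u) ≤ A * N * (l * u) := by
      rw [mul_assoc]
      gcongr
    -- All fairness errors other than `η` are `O(l u)` and together cost one more unit, so the
    -- constant `8` of `relax_upper` becomes `9`.
    have h7 : (K₂ * (K₀ + Q) + 2 * (K₁ * Q) + A * N) * (l * u) ≤ M * lp * n * u := by
      calc _ ≤ l * (l * u) := by
            have := q8.trans hl
            gcongr
        _ = 1 * l ^ 2 * 1 * u := by ring
        _ ≤ _ := by gcongr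
    linarith only [h1, h2, h3, h4, h5, h6, h7, hηup, hρτ]

end

/-! ### Assembly of the regret bounds -/

theorem theorem3 :
    ∃ C : ℝ, 0 < C ∧
      ∀ (N M Q : ℕ), 0 < N → 0 < M → 0 < Q →
      ∀ parr : ℕ → Fin M → ℝ, (∀ t, parr t ∈ stdSimplex ℝ (Fin M)) →
        (∀ t, parr (t + Q) = parr t) → (∀ j, 0 < meanArrival parr Q j) →
      ∀ y : Fin N → Fin M → ℝ, (∀ i j, y i j ∈ Set.Ioo (0 : ℝ) 1) →
      ∀ r : Fin N → ℝ, (∀ i, 0 < r i) →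
      ∀ S : Spec N M, S.Valid → S.LocallyLipschitzAt (meanArrival parr Q, y, r) →
      ∃ T₀ : ℕ, ∀ T : ℕ, T₀ ≤ T →
      ∀ xhat : History N M → Fin N → Fin M → ℝ, IsFORM S r Q T xhat →
      ∀ xstar : Fin N → Fin M → ℝ, S.IsOptimal (meanArrival parr T, y, r) 0 xstar →
        expect parr y xhat T (revRegret (meanArrival parr T, y, r) xhat xstar T) ≤
          C * Q * ‖r‖ * (M * (N : ℝ) ^ (1 / 3 : ℝ) * (T : ℝ) ^ (-(1 / 3) : ℝ)) ∧
        expect parr y xhat T (fairRegret S (meanArrival parr T, y, r) xhat T) ≤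
          C * Real.log T ^ (5 / 2 : ℝ) *
            (M * (N : ℝ) ^ (1 / 3 : ℝ) * (T : ℝ) ^ (-(1 / 3) : ℝ)) := by
  -- Summing `t ^ (-1/3)` doubles the constant `9` of a fairness round, and the bad rounds add `1`.
  -- Revenue needs only `2 * 2 + 1 = 5`.
  refine ⟨19, by norm_num, ?_⟩
  intro N M Q hN hM hQ parr hp hper hpos y hy r hr S hS hL
  obtain ⟨V, hV, hround⟩ := exists_round_bound hN hM hQ hp hper hpos hy hr hS hL
  -- This threshold for `T ^ (1/6)` makes the cost of the bad rounds, `√T + 1 + E` with `E = 6 N M +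
  -- 12 M`, at most `T ^ (2/3)` even after multiplication by `1 + V`. The factor serves both the
  -- revenue (loss at most `‖r‖`) and the fairness (loss at most `V`).
  obtain ⟨T₀, hT₀⟩ := hround ((1 + V) * (2 + (6 * N * M + 12 * M)))
  refine ⟨max 1 T₀, fun T hT xhat hF xstar hxs => ?_⟩
  have hT1 : 1 ≤ T := (le_max_left _ _).trans hT
  have hTpos : (0 : ℝ) < T := by exact_mod_cast hT1
  obtain ⟨⟨hv, hl⟩, hθT, hNk, hrest⟩ := hT₀ T ((le_max_right _ _).trans hT)
  obtain ⟨hbad, hgood⟩ := hrest xhat hF xstar hxs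
  have hN1 : (1 : ℝ) ≤ N := by exact_mod_cast hN
  have hM1 : (1 : ℝ) ≤ M := by exact_mod_cast hM
  have hQ1 : (1 : ℝ) ≤ Q := by exact_mod_cast hQ
  have hx : ∀ h, xhat h ∈ recommendations N M := fun h => (hF h).1
  have hw : 1 ≤ window Q T := Nat.one_le_iff_ne_zero.2 (Nat.pos_iff_ne_zero.1
    (Nat.ceil_pos.2 (by positivity)))
  have hn1 : 1 ≤ (N : ℝ) ^ (1 / 3 : ℝ) := Real.one_le_rpow hN1 (by norm_num)
  have hlp : 1 ≤ Real.log T ^ (5 / 2 : ℝ) := Real.one_le_rpow hl (by norm_num)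
  set θT : Instance N M := (meanArrival parr T, y, r) with hθTdef
  set l := Real.log T with hldef
  set n := (N : ℝ) ^ (1 / 3 : ℝ) with hn
  set lp := l ^ (5 / 2 : ℝ) with hlpdef
  set E : ℝ := 6 * N * M + 12 * M with hE
  have hE0 : 0 ≤ E := by positivity
  set v := (T : ℝ) ^ (1 / 6 : ℝ) with hvdef
  have hv0 : 0 < v := by positivity
  have hv6 : v ^ 6 = T := by
    rw [hvdef, ← Real.rpow_natCast, ← Real.rpow_mul hTpos.le]; norm_num
  have hv4 : (T : ℝ) ^ (2 / 3 : ℝ) = v ^ 4 := by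
    rw [hvdef, ← Real.rpow_natCast, ← Real.rpow_mul hTpos.le]; norm_num
  have hv2 : (T : ℝ) ^ (-(1 / 3) : ℝ) = (v ^ 2)⁻¹ := by
    rw [Real.rpow_neg hTpos.le, hvdef, ← Real.rpow_natCast, ← Real.rpow_mul hTpos.le]; norm_num
  have hv3 : Real.sqrt T = v ^ 3 := by
    rw [← hv6, show v ^ 6 = (v ^ 3) ^ 2 by ring, Real.sqrt_sq (by positivity)]
  have hv1 : 1 ≤ v := by
    refine le_trans ?_ hv
    exact one_le_mul_of_one_le_of_one_le (by linarith) (by linarith)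
  have hover : (1 + V) * (Real.sqrt T + 1 + E) ≤ v ^ 4 := by
    rw [hv3]
    have h1 : v ^ 3 + 1 + E ≤ (2 + E) * v ^ 3 := by
      nlinarith [one_le_pow₀ hv1 (n := 3)]
    calc (1 + V) * (v ^ 3 + 1 + E) ≤ (1 + V) * ((2 + E) * v ^ 3) := by gcongr
      _ = (1 + V) * (2 + E) * v ^ 3 := by ring
      _ ≤ v * v ^ 3 := by gcongr
      _ = v ^ 4 := by ring
  have hfin : ∀ b B c : ℝ, B * (Real.sqrt T + 1 + E) ≤ c * v ^ 4 →
      1 / (T : ℝ) * (b * (2 * (T : ℝ) ^ (2 / 3 : ℝ)) + B * (Real.sqrt T + 1 + E)) ≤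
        (2 * b + c) * (T : ℝ) ^ (-(1 / 3) : ℝ) := by
    intro b B c h1
    have h2 : (2 * b + c) * (T : ℝ) ^ (-(1 / 3) : ℝ) =
        1 / (T : ℝ) * (b * (2 * (T : ℝ) ^ (2 / 3 : ℝ)) + c * v ^ 4) := by
      rw [hv2, hv4, ← hv6]; field_simp
    rw [h2]
    gcongr
  have hS0 : 0 ≤ Real.sqrt T + 1 + E := by positivity
  set a : ℝ := (T : ℝ) ^ (-(1 / 3) : ℝ) with ha
  have ha0 : 0 < a := by positivity
  set R := ‖r‖ with hR
  have hR0 : 0 ≤ R := norm_nonneg _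
  have hlen : ∀ h : History N M, h.length = T → ∀ k < T, (h.drop (T - k)).length = k := by
    intro h hh k hk
    rw [List.length_drop, hh]; omega
  classical
  constructor
  · have h1 := expect_average_le hp hy hx hN hT1 hw hNk (b := 2 * R * n) (B := R) (by positivity)
      hR0 (F := revRegret θT xhat xstar T) (fun h hh => by
        unfold revRegret
        refine mul_le_mul_of_nonneg_left (Finset.sum_le_sum fun k hk => ?_) (by positivity)
        rw [Finset.mem_range] at hk
        have hlk := hlen h hh k hk
        unfold xRound
        split_ifs with hc
        · have := (hgood (h.drop (T - k)) (by rw [hlk]; exact hk) (by rw [hlk]; exact hc.1)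
            hc.2).1
          rw [hlk] at this
          rw [mul_zero, add_zero]
          exact this
        · have h2 := rev_le hθT hxs.1.1
          have h3 := rev_nonneg hθT (x := xRec xhat (h.drop (T - k)))
            fun i j => (xRec_mem (hx _) j).1 i
          have h4 : 0 ≤ 2 * R * n * ((k + 1 : ℕ) : ℝ) ^ (-(1 / 3) : ℝ) := by positivity
          rw [show θT.r = r from rfl, ← hR] at h2
          rw [mul_one]
          linarith)
    refine h1.trans ((hfin (2 * R * n) R R ?_).trans ?_)
    · refine mul_le_mul_of_nonneg_left ?_ hR0
      nlinarith [mul_nonneg hV hS0]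
    · have h2 : R ≤ R * n := le_mul_of_one_le_right hR0 hn1
      calc (2 * (2 * R * n) + R) * a ≤ (2 * (2 * R * n) + R * n) * a := by gcongr
        _ = 5 * 1 * R * (1 * n * a) := by ring
        _ ≤ 19 * Q * R * (M * n * a) := by gcongr; norm_num
  · have hterm : ∀ h : History N M, h.length = T → ∀ q k, k < T →
        max (violation S θT (xRec xhat (h.drop (T - k))) q) 0 ≤
          9 * M * lp * n * ((k + 1 : ℕ) : ℝ) ^ (-(1 / 3) : ℝ) +
            V * if T ≤ k ^ 2 ∧ Concentrated parr y xhat (window Q T) l (h.drop (T - k))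
              then 0 else 1 := by
      intro h hh q k hk
      have hlk := hlen h hh k hk
      have h4 : 0 ≤ 9 * M * lp * n * ((k + 1 : ℕ) : ℝ) ^ (-(1 / 3) : ℝ) := by positivity
      split_ifs with hc
      · have := (hgood (h.drop (T - k)) (by rw [hlk]; exact hk) (by rw [hlk]; exact hc.1)
            hc.2).2 q
        rw [hlk] at this
        rw [mul_zero, add_zero]
        exact max_le this h4
      · have := hbad (h.drop (T - k)) q
        rw [mul_one]
        exact max_le (by linarith) (by linarith)
    have h1 := expect_average_le hp hy hx hN hT1 hw hNk (b := 9 * M * lp * n) (B := V)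
      (by positivity) hV (F := fairRegret S θT xhat T) (fun h hh => by
        have : Nonempty (Fin N) := ⟨⟨0, hN⟩⟩
        have : Nonempty (Fin M) := ⟨⟨0, hM⟩⟩
        unfold fairRegret
        refine max_le (ciSup_le fun i => ?_) (ciSup_le fun j => ?_)
        · refine mul_le_mul_of_nonneg_left (Finset.sum_le_sum fun k hk => ?_) (by positivity)
          exact hterm h hh (Sum.inl i) k (Finset.mem_range.1 hk)
        · refine mul_le_mul_of_nonneg_left (Finset.sum_le_sum fun k hk => ?_) (by positivity)
          exact hterm h hh (Sum.inr j) k (Finset.mem_range.1 hk))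
    refine h1.trans ((hfin (9 * M * lp * n) V 1 ?_).trans ?_)
    · linarith
    · have h2 : 1 ≤ M * lp * n :=
        one_le_mul_of_one_le_of_one_le (one_le_mul_of_one_le_of_one_le hM1 hlp) hn1
      calc (2 * (9 * M * lp * n) + 1) * a ≤ (2 * (9 * M * lp * n) + M * lp * n) * a := by gcongr
        _ = 19 * lp * (M * n * a) := by ring
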